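/- Let $\zeta=e^{2\pi i/6}$, let $\Lambda\subset\mathbb C$ be the lattice spanned by $1$ and $\zeta$, let $n\ge 1$ and $T^{2n}=(\mathbb C/\Lambda)^n$, and let $B\colon T^{2n}\to T^{2n}$ be the homeomorphism covered by $\mathrm{diag}(\zeta,\dots,\zeta)$ on $\mathbb C^n$. Let $$T^{2n}_B=\frac{T^{2n}\times[0,1]}{(x,0)\sim(B(x),1)}$$ be the mapping torus of $B$. A *Kähler structure* on a smooth manifold is a pair $(J,g)$ of a smooth $(1,1)$-tensor $J$ with $J^2=-I$ and $[J,J]=0$, and a Riemannian metric $g$ with $g(JX,JY)=g(X,Y)$, such that $\omega(X,Y)=g(JX,Y)$ is closed; a *Hermitian isometry* is a smooth self-map whose differential commutes with $J$ and preserves $g$. A *co-Kähler structure* on a smooth manifold is a quadruple $(J,\xi,\eta,g)$ of a smooth $(1,1)$-tensor, a smooth vector field, a smooth $1$-form and a Riemannian metric with $J^2=-I+\eta\otimes\xi$, $\eta(\xi)=1$, $g(JX,JY)=g(X,Y)-\eta(X)\eta(Y)$, such that $[J,J]+2\,d\eta\otimes\xi=0$ and, for $\omega(X,Y)=g(JX,Y)$,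 $d\omega=0=d\eta$. Then: 1. $T^{2n}$ is a compact Hausdorff space and carries a smooth structure for which $\mathbb C^n\to T^{2n}$ is a local diffeomorphism, together with a Kähler structure whose pull-back to $\mathbb C^n$ is the standard one; $B$ is a Hermitian isometry of it, of order exactly $6$. 2. $T^{2n}_B$ is compact Hausdorff and carries a smooth structure of dimension $2n+1$ for which the map $T^{2n}\times\mathbb R\to T^{2n}_B$, $(x,t)\mapsto[B^{-\lfloor t\rfloor}x,\,t-\lfloor t\rfloor]$, is a local diffeomorphism; with this smooth structure it admits a co-Kähler structure. 3. $H_1(T^{2n}_B;\mathbb Z)\cong\mathbb Z$ (singular homology), so $b_1(T^{2n}_B)=\operatorname{rank}H_1(T^{2n}_B;\mathbb Z)=1$, and $\pi_1(T^{2n}_B,x)$ is solvable for every base point $x$. 4. There is a $6$-sheeted covering map from the torus $T^{2n}\times S^1$ onto $T^{2n}_B$. 5. For every compact topological manifold $K$ of dimension $2n$ (Hausdorff, without boundary, not necessarily connected), $T^{2n}_B$ is not homeomorphic to $K\times S^1$. -/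

import Mathlib

open scoped Manifold ContDiff Topology Bundle

noncomputable section

/-! ### Tensors on a smooth manifold -/

section Tensors

/-- A smooth vector field on the manifold `M`. -/
def IsSmoothVectorField {E : Type*} [NormedAddCommGroup E] [NormedSpace ℝ E]
    {H : Type*} [TopologicalSpace H] (I : ModelWithCorners ℝ E H)
    {M : Type*} [TopologicalSpace M] [ChartedSpace H M] [IsManifold I ∞ M]
    (X : ∀ x : M, TangentSpace I x) : Prop :=
  ContMDiff I (I.prod 𝓘(ℝ, E)) ∞ (fun x => Bundle.TotalSpace.mk' E x (X x))

/-- A smooth tensor field of type `(1,1)`, i.e. a smooth field of endomorphisms of `TM`. -/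
def IsSmoothEndomorphismField {E : Type*} [NormedAddCommGroup E] [NormedSpace ℝ E]
    {H : Type*} [TopologicalSpace H] (I : ModelWithCorners ℝ E H)
    {M : Type*} [TopologicalSpace M] [ChartedSpace H M] [IsManifold I ∞ M]
    (J : ∀ x : M, TangentSpace I x →L[ℝ] TangentSpace I x) : Prop :=
  ContMDiff I (I.prod 𝓘(ℝ, E →L[ℝ] E)) ∞
    (fun x => Bundle.TotalSpace.mk' (E →L[ℝ] E)
      (E := fun x : M => TangentSpace I x →L[ℝ] TangentSpace I x) x (J x))

/-- A smooth differential `1`-form. -/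
def IsSmoothOneForm {E : Type*} [NormedAddCommGroup E] [NormedSpace ℝ E]
    {H : Type*} [TopologicalSpace H] (I : ModelWithCorners ℝ E H)
    {M : Type*} [TopologicalSpace M] [ChartedSpace H M] [IsManifold I ∞ M]
    (η : ∀ x : M, TangentSpace I x →L[ℝ] ℝ) : Prop :=
  ContMDiff I (I.prod 𝓘(ℝ, E →L[ℝ] ℝ)) ∞
    (fun x => Bundle.TotalSpace.mk' (E →L[ℝ] ℝ)
      (E := fun x : M => TangentSpace I x →L[ℝ] Bundle.Trivial M ℝ x) x (η x))

/-- The derivative `X f` of a function along a vector field, at the point `x`. -/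
def dirDeriv {E : Type*} [NormedAddCommGroup E] [NormedSpace ℝ E]
    {H : Type*} [TopologicalSpace H] (I : ModelWithCorners ℝ E H)
    {M : Type*} [TopologicalSpace M] [ChartedSpace H M]
    (X : ∀ x : M, TangentSpace I x) (f : M → ℝ) (x : M) : ℝ :=
  mfderiv I 𝓘(ℝ, ℝ) f x (X x)

/-- The exterior derivative of a `1`-form evaluated on two vector fields:
`dη(X, Y) = X(η(Y)) - Y(η(X)) - η([X, Y])`. -/
def extDerivOneForm {E : Type*} [NormedAddCommGroup E] [NormedSpace ℝ E]
    {H : Type*} [TopologicalSpace H] (I : ModelWithCorners ℝ E H)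
    {M : Type*} [TopologicalSpace M] [ChartedSpace H M]
    (η : ∀ x : M, TangentSpace I x →L[ℝ] ℝ) (X Y : ∀ x : M, TangentSpace I x) (x : M) : ℝ :=
  dirDeriv I X (fun y => η y (Y y)) x - dirDeriv I Y (fun y => η y (X y)) x
    - η x (VectorField.mlieBracket I X Y x)

/-- The exterior derivative of a `2`-form evaluated on three vector fields:
`dσ(X, Y, Z)` is the sum over the cyclic permutations of `X, Y, Z` of
`X(σ(Y, Z)) - σ([X, Y], Z)`. -/
def extDerivTwoForm {E : Type*} [NormedAddCommGroup E] [NormedSpace ℝ E]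
    {H : Type*} [TopologicalSpace H] (I : ModelWithCorners ℝ E H)
    {M : Type*} [TopologicalSpace M] [ChartedSpace H M]
    (σ : ∀ x : M, TangentSpace I x → TangentSpace I x → ℝ)
    (X Y Z : ∀ x : M, TangentSpace I x) (x : M) : ℝ :=
  dirDeriv I X (fun y => σ y (Y y) (Z y)) x
    + dirDeriv I Y (fun y => σ y (Z y) (X y)) x
    + dirDeriv I Z (fun y => σ y (X y) (Y y)) x
    - σ x (VectorField.mlieBracket I X Y x) (Z x)
    - σ x (VectorField.mlieBracket I Y Z x) (X x)
    - σ x (VectorField.mlieBracket I Z X x) (Y x)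

/-- The Nijenhuis torsion `[J, J](X, Y) = J²[X, Y] + [JX, JY] - J[JX, Y] - J[X, JY]`
of a field of endomorphisms. -/
def nijenhuis {E : Type*} [NormedAddCommGroup E] [NormedSpace ℝ E]
    {H : Type*} [TopologicalSpace H] (I : ModelWithCorners ℝ E H)
    {M : Type*} [TopologicalSpace M] [ChartedSpace H M]
    (J : ∀ x : M, TangentSpace I x →L[ℝ] TangentSpace I x)
    (X Y : ∀ x : M, TangentSpace I x) (x : M) : TangentSpace I x :=
  J x (J x (VectorField.mlieBracket I X Y x))
    + VectorField.mlieBracket I (fun y => J y (X y)) (fun y => J y (Y y)) x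
    - J x (VectorField.mlieBracket I (fun y => J y (X y)) Y x)
    - J x (VectorField.mlieBracket I X (fun y => J y (Y y)) x)

end Tensors

/-! ### Kähler and co-Kähler structures -/

section Structures

/-- A Kähler structure on a smooth manifold: an integrable almost complex structure `J` and a
Riemannian metric `g` for which `J` is orthogonal, such that the fundamental form
`ω(X, Y) = g(JX, Y)` is closed. -/
structure KahlerStructure {E : Type*} [NormedAddCommGroup E] [NormedSpace ℝ E]
    {H : Type*} [TopologicalSpace H] (I : ModelWithCorners ℝ E H)
    (M : Type*) [TopologicalSpace M] [ChartedSpace H M] [IsManifold I ∞ M] where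
  /-- the complex structure on the tangent bundle -/
  J : ∀ x : M, TangentSpace I x →L[ℝ] TangentSpace I x
  /-- the Riemannian metric -/
  g : Bundle.ContMDiffRiemannianMetric I ∞ E (fun x : M => TangentSpace I x)
  smooth_J : IsSmoothEndomorphismField I J
  J_sq : ∀ (x : M) (u : TangentSpace I x), J x (J x u) = -u
  compatible : ∀ (x : M) (u v : TangentSpace I x),
    g.inner x (J x u) (J x v) = g.inner x u v
  integrable : ∀ X Y : ∀ x : M, TangentSpace I x,
    IsSmoothVectorField I X → IsSmoothVectorField I Y →
      ∀ x : M, nijenhuis I J X Y x = 0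
  closed : ∀ X Y Z : ∀ x : M, TangentSpace I x,
    IsSmoothVectorField I X → IsSmoothVectorField I Y → IsSmoothVectorField I Z →
      ∀ x : M, extDerivTwoForm I (fun y u v => g.inner y (J y u) v) X Y Z x = 0

/-- A Hermitian isometry of a Kähler manifold: a smooth self-map that is holomorphic
(its differential commutes with `J`) and preserves the metric. -/
def KahlerStructure.IsHermitianIsometry {E : Type*} [NormedAddCommGroup E] [NormedSpace ℝ E]
    {H : Type*} [TopologicalSpace H] {I : ModelWithCorners ℝ E H}
    {M : Type*} [TopologicalSpace M] [ChartedSpace H M] [IsManifold I ∞ M]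
    (S : KahlerStructure I M) (φ : M → M) : Prop :=
  ContMDiff I I ∞ φ ∧
  (∀ (x : M) (u : TangentSpace I x),
    mfderiv I I φ x (S.J x u) = S.J (φ x) (mfderiv I I φ x u)) ∧
  (∀ (x : M) (u v : TangentSpace I x),
    S.g.inner (φ x) (mfderiv I I φ x u) (mfderiv I I φ x v) = S.g.inner x u v)

/-- A co-Kähler structure `(J, ξ, η, g)` on a smooth manifold: an almost contact metric structure
with `[J, J] + 2 dη ⊗ ξ = 0` for which `η` and `ω(X, Y) = g(JX, Y)` are closed. -/
structure CoKahlerStructure {E : Type*} [NormedAddCommGroup E] [NormedSpace ℝ E]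
    {H : Type*} [TopologicalSpace H] (I : ModelWithCorners ℝ E H)
    (M : Type*) [TopologicalSpace M] [ChartedSpace H M] [IsManifold I ∞ M] where
  /-- the tensor of type `(1,1)` -/
  J : ∀ x : M, TangentSpace I x →L[ℝ] TangentSpace I x
  /-- the vector field -/
  ξ : ∀ x : M, TangentSpace I x
  /-- the `1`-form -/
  η : ∀ x : M, TangentSpace I x →L[ℝ] ℝ
  /-- the Riemannian metric -/
  g : Bundle.ContMDiffRiemannianMetric I ∞ E (fun x : M => TangentSpace I x)
  smooth_J : IsSmoothEndomorphismField I J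
  smooth_ξ : IsSmoothVectorField I ξ
  smooth_η : IsSmoothOneForm I η
  J_sq : ∀ (x : M) (u : TangentSpace I x), J x (J x u) = -u + η x u • ξ x
  η_ξ : ∀ x : M, η x (ξ x) = 1
  compatible : ∀ (x : M) (u v : TangentSpace I x),
    g.inner x (J x u) (J x v) = g.inner x u v - η x u * η x v
  normal : ∀ X Y : ∀ x : M, TangentSpace I x,
    IsSmoothVectorField I X → IsSmoothVectorField I Y →
      ∀ x : M, nijenhuis I J X Y x + (2 * extDerivOneForm I η X Y x) • ξ x = 0
  closed_omega : ∀ X Y Z : ∀ x : M, TangentSpace I x,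
    IsSmoothVectorField I X → IsSmoothVectorField I Y → IsSmoothVectorField I Z →
      ∀ x : M, extDerivTwoForm I (fun y u v => g.inner y (J y u) v) X Y Z x = 0
  closed_eta : ∀ X Y : ∀ x : M, TangentSpace I x,
    IsSmoothVectorField I X → IsSmoothVectorField I Y →
      ∀ x : M, extDerivOneForm I η X Y x = 0

end Structures

/-! ### Mapping tori -/

section MappingTorus

/-- The identifications `(x, 0) ∼ (φ x, 1)` on `K × [0, 1]`. -/
inductive MappingTorusRel {K : Type*} (φ : K → K) : K × unitInterval → K × unitInterval → Prop
  | glue (x : K) : MappingTorusRel φ (x, 0) (φ x, 1)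

/-- The mapping torus `K × [0, 1] / (x, 0) ∼ (φ x, 1)`. -/
def MappingTorus {K : Type*} (φ : K → K) : Type _ := Quot (MappingTorusRel φ)

instance {K : Type*} [TopologicalSpace K] (φ : K → K) : TopologicalSpace (MappingTorus φ) :=
  inferInstanceAs (TopologicalSpace (Quot (MappingTorusRel φ)))

/-- The map `K × ℝ → K_φ` extending `K × [0, 1] → K_φ` by the rule that `(x, t)` and
`(φ x, t + 1)` have the same image: `(x, t) ↦ [φ^{-⌊t⌋} x, t - ⌊t⌋]`. -/
def MappingTorus.cover {K : Type*} [TopologicalSpace K] (φ : K ≃ₜ K) (p : K × ℝ) :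
    MappingTorus φ :=
  Quot.mk _ ((φ ^ (-⌊p.2⌋)) p.1, ⟨Int.fract p.2, Int.fract_nonneg _, (Int.fract_lt_one _).le⟩)

end MappingTorus

/-! ### The first Betti number -/

section Betti

/-- First singular homology with integer coefficients. -/
abbrev H₁ (X : Type) [TopologicalSpace X] : ModuleCat.{0} ℤ :=
  ((AlgebraicTopology.singularHomologyFunctor (ModuleCat.{0} ℤ) 1).obj (ModuleCat.of ℤ ℤ)).obj
    (TopCat.of X)

/-- The first Betti number, the rank of the first integral homology group. -/
def firstBetti (X : Type) [TopologicalSpace X] : Cardinal := Module.rank ℤ (H₁ X)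

end Betti

/-! ### The torus `T²ⁿ` and its isometry `B` -/

section Torus

/-- `ζ = e^{2πi/6}`. -/
def zeta : ℂ := Complex.exp (2 * Real.pi * Complex.I / 6)

/-- The lattice in `ℂ` spanned by `1` and `ζ`. -/
def eisensteinLattice : AddSubgroup ℂ := AddSubgroup.closure {1, zeta}

/-- `T²ⁿ = (ℂ / Λ)ⁿ`. -/
abbrev Torus (n : ℕ) : Type := Fin n → ℂ ⧸ eisensteinLattice

/-- The quotient map `ℂⁿ → T²ⁿ`. -/
def torusProj (n : ℕ) (z : EuclideanSpace ℂ (Fin n)) : Torus n :=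
  fun i => QuotientAddGroup.mk (z i)

theorem zeta_sq : zeta * zeta = zeta - 1 := by
  have h : zeta = ⟨1 / 2, √3 / 2⟩ := by
    have e : (2 * Real.pi * Complex.I / 6 : ℂ) = ((Real.pi / 3 : ℝ) : ℂ) * Complex.I := by
      push_cast; ring
    rw [zeta, e, Complex.exp_mul_I, ← Complex.ofReal_cos, ← Complex.ofReal_sin,
      Real.cos_pi_div_three, Real.sin_pi_div_three]
    apply Complex.ext <;> simp
  have h3 : √3 * √3 = 3 := Real.mul_self_sqrt (by norm_num)
  rw [h]
  apply Complex.ext <;> simp <;> nlinarith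

theorem zeta_ne_zero : zeta ≠ 0 := Complex.exp_ne_zero _

/-- Multiplication by `ζ` on `ℂ`. -/
def mulZeta : ℂ ≃+ ℂ where
  toFun z := zeta * z
  invFun z := zeta⁻¹ * z
  left_inv z := inv_mul_cancel_left₀ zeta_ne_zero z
  right_inv z := mul_inv_cancel_left₀ zeta_ne_zero z
  map_add' := mul_add zeta

theorem map_mulZeta : eisensteinLattice.map (mulZeta : ℂ →+ ℂ) = eisensteinLattice := by
  have h1 : (1 : ℂ) ∈ eisensteinLattice := AddSubgroup.subset_closure (by simp)
  have hz : zeta ∈ eisensteinLattice := AddSubgroup.subset_closure (by simp)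
  apply le_antisymm
  · rw [eisensteinLattice, AddMonoidHom.map_closure, AddSubgroup.closure_le]
    rintro _ ⟨x, rfl | rfl, rfl⟩
    · have e : (mulZeta : ℂ →+ ℂ) 1 = zeta := by simp [mulZeta]
      rw [e]; exact hz
    · have e : (mulZeta : ℂ →+ ℂ) zeta = zeta - 1 := by simp [mulZeta, zeta_sq]
      rw [e]; exact sub_mem hz h1
  · conv_lhs => rw [eisensteinLattice]
    rw [AddSubgroup.closure_le]
    rintro x (rfl | rfl)
    · refine ⟨1 - zeta, sub_mem h1 hz, ?_⟩
      simp [mulZeta, mul_sub, zeta_sq]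
    · exact ⟨1, h1, by simp [mulZeta]⟩

/-- The self-homeomorphism of `ℂ / Λ` covered by multiplication by `ζ`. -/
def rotateCircleTorus : ℂ ⧸ eisensteinLattice ≃ₜ ℂ ⧸ eisensteinLattice where
  toEquiv := (QuotientAddGroup.congr _ _ mulZeta map_mulZeta).toEquiv
  continuous_toFun := by
    refine continuous_quot_lift _ ?_
    exact continuous_quot_mk.comp (continuous_const.mul continuous_id)
  continuous_invFun := by
    refine continuous_quot_lift _ ?_
    exact continuous_quot_mk.comp (continuous_const.mul continuous_id)

/-- `B : T²ⁿ → T²ⁿ`, covered by `diag(ζ, …, ζ)`. -/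
def torusB (n : ℕ) : Torus n ≃ₜ Torus n := Homeomorph.piCongrRight fun _ => rotateCircleTorus

theorem torusB_torusProj (n : ℕ) (z : EuclideanSpace ℂ (Fin n)) :
    torusB n (torusProj n z) = torusProj n (zeta • z) := rfl

/-- The mapping torus `T²ⁿ_B`. -/
abbrev TorusB (n : ℕ) : Type := MappingTorus (torusB n)

end Torus

end

noncomputable section

/-! ### Mapping tori as quotients of `K × ℝ` -/

namespace MappingTorus

variable {K : Type*} [TopologicalSpace K] (φ : K ≃ₜ K)

/-! Everything is read off from the covering `torusBProj` of the mapping torus by ℂⁿ × ℝ. By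
`torusBProj_eq_iff` and `isQuotientCoveringMap_torusBProj` it is the quotient by the free action of
the group Γ (`deckGroup`) of the maps (z, t) ↦ (ζᵏz + l, t + k), with k an integer and l in Λⁿ. So Γ
is the semidirect product of Λⁿ with ℤ, whose generator acts by ζ.

The arithmetic input is ζ - 1 = ζ², a unit of Λ. It makes every translation a commutator
(`mk_zero_eq_commutator`), so the abelianization of Γ is ℤ. Since ℂⁿ × ℝ is simply connected, π₁ is
Γ up to reversal of the product, hence solvable. H₁ is the abelianization of Γ by
`firstHomologyEquiv`, a Hurewicz theorem proved directly on singular chains: paths are lifted and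
replaced by segments.

For the product question, a homeomorphism with K × S¹ would let the circle act by rotations. Lifting
one full turn gives a central γ in Γ, and the circle coordinate gives a homomorphism from Γ to 2πℤ
with value 2π at γ (`exists_central_of_homeomorph_prod_circle`). But every central element of Γ is a
sixth power (`exists_eq_shift_zpow_of_commute`), so that value would be divisible by 6 in 2πℤ.
Conversely B⁶ = 1 untwists the bundle after going round six times, which is the six-sheeted covering
by T²ⁿ × S¹.

The geometric structures descend from ℂⁿ and ℂⁿ × ℝ. Deck transformations are affine with linear
part a power of ζ (trivial for T²ⁿ), so the constant tensors of the flat model are invariant.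
`IsAffineCover` isolates this: invariant constant tensors are smooth on the quotient, and the
integrability and closedness identities are checked on lifted vector fields, where brackets are
given by ordinary derivatives. -/

theorem cover_map_add_one (x : K) (t : ℝ) : cover φ (φ x, t + 1) = cover φ (x, t) := by
  unfold cover
  congr 1
  refine Prod.ext ?_ (Subtype.ext (Int.fract_add_one t))
  change (φ ^ (-⌊t + 1⌋)) (φ x) = (φ ^ (-⌊t⌋)) x
  rw [Int.floor_add_one, neg_add, zpow_add, zpow_neg_one]
  change (φ ^ (-⌊t⌋)) (φ.symm (φ x)) = _
  rw [φ.symm_apply_apply]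

theorem cover_zpow_add (k : ℤ) (x : K) (t : ℝ) :
    cover φ ((φ ^ k) x, t + k) = cover φ (x, t) := by
  induction k with
  | zero => simp
  | succ k ih =>
    rw [← ih, add_comm (k : ℤ) 1, zpow_add, zpow_one]
    have := cover_map_add_one φ ((φ ^ (k : ℤ)) x) (t + (k : ℤ))
    rw [← this]
    push_cast
    congr 2
    ring
  | pred k ih =>
    rw [← ih, ← cover_map_add_one φ, ← Homeomorph.mul_apply, ← zpow_one_add,
      show (1 : ℤ) + (-k - 1) = -k by ring]
    push_cast
    congr 2
    ring

theorem mk_eq_cover (x : K) (t : unitInterval) :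
    (Quot.mk _ (x, t) : MappingTorus φ) = cover φ (x, t) := by
  rcases lt_or_eq_of_le t.2.2 with h | h
  · have hf : ⌊(t : ℝ)⌋ = 0 := Int.floor_eq_zero_iff.2 ⟨t.2.1, h⟩
    have hfr : Int.fract (t : ℝ) = t := Int.fract_eq_self.2 ⟨t.2.1, h⟩
    simp [cover, hf, hfr]
  · obtain rfl : t = 1 := Subtype.ext h
    have h1 : cover φ (x, ((1 : unitInterval) : ℝ)) = cover φ (φ.symm x, 0) := by
      rw [← cover_map_add_one φ (φ.symm x) 0, φ.apply_symm_apply]; simp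
    rw [h1]
    have h2 : (Quot.mk _ (φ.symm x, 0) : MappingTorus φ) = Quot.mk _ (φ (φ.symm x), 1) :=
      Quot.sound (.glue _)
    rw [φ.apply_symm_apply] at h2
    rw [← h2]
    simp [cover]

theorem cover_surjective : Function.Surjective (cover φ) := by
  rintro ⟨x, t⟩
  exact ⟨(x, t), (mk_eq_cover φ x t).symm⟩

/-- The orbit relation of the action of `ℤ` on `K × ℝ` generated by `(x, t) ↦ (φ x, t + 1)`. -/
def coverSetoid : Setoid (K × ℝ) where
  r p p' := ∃ k : ℤ, p' = ((φ ^ k) p.1, p.2 + k)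
  iseqv :=
    { refl := fun p => ⟨0, by simp⟩
      symm := by
        rintro p _ ⟨k, rfl⟩
        refine ⟨-k, ?_⟩
        simp [← Homeomorph.mul_apply]
      trans := by
        rintro p _ _ ⟨k, rfl⟩ ⟨l, rfl⟩
        refine ⟨l + k, ?_⟩
        rw [zpow_add, Homeomorph.mul_apply]
        push_cast
        congr 1
        ring }

theorem cover_eq_iff {p p' : K × ℝ} :
    cover φ p = cover φ p' ↔ ∃ k : ℤ, p' = ((φ ^ k) p.1, p.2 + k) := by
  constructor
  · intro h
    -- The inclusion of K × [0, 1] in K × ℝ respects the gluing modulo orbits, so points with equal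
    -- images in the mapping torus lie in the same orbit.
    let F : MappingTorus φ → Quotient (coverSetoid φ) :=
      Quot.lift (fun q => Quotient.mk (coverSetoid φ) (q.1, (q.2 : ℝ))) (by
        rintro _ _ ⟨x⟩
        exact Quotient.sound (s := coverSetoid φ) ⟨1, by simp⟩)
    have hF : ∀ q : K × ℝ, F (cover φ q) = Quotient.mk (coverSetoid φ) q := by
      intro q
      refine Quotient.sound (s := coverSetoid φ) ⟨⌊q.2⌋, ?_⟩
      refine Prod.ext ?_ ?_
      · change q.1 = (φ ^ ⌊q.2⌋) ((φ ^ (-⌊q.2⌋)) q.1)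
        rw [← Homeomorph.mul_apply, ← zpow_add, add_neg_cancel, zpow_zero]
        rfl
      · exact (Int.fract_add_floor q.2).symm
    have := congrArg F h
    rw [hF, hF] at this
    exact Quotient.exact this
  · rintro ⟨k, rfl⟩
    exact (cover_zpow_add φ k p.1 p.2).symm

/-- The formula jumps at integers, so continuity is checked on the locally finite closed strips K ×
[m, m + 1]. There the map agrees with (x, t) ↦ [φ⁻ᵐx, t - m], at the right end because of the
gluing. -/
theorem continuous_cover : Continuous (cover φ) := by
  have hlf : LocallyFinite fun m : ℤ => (Set.univ : Set K) ×ˢ Set.Icc (m : ℝ) (m + 1) := by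
    rintro ⟨x, t⟩
    refine ⟨Set.univ ×ˢ Set.Ioo (t - 1) (t + 1), prod_mem_nhds Filter.univ_mem
      (Ioo_mem_nhds (by linarith) (by linarith)), ?_⟩
    refine (Set.finite_Icc (⌊t⌋ - 2) (⌊t⌋ + 2)).subset ?_
    rintro m ⟨⟨y, s⟩, ⟨-, h1, h2⟩, -, h3, h4⟩
    have h5 := Int.floor_le t
    have h6 := Int.lt_floor_add_one t
    simp only at h1 h2 h3 h4
    constructor
    · have : ((⌊t⌋ - 2 : ℤ) : ℝ) < m + 1 := by push_cast; linarith
      have : ⌊t⌋ - 2 < m + 1 := by exact_mod_cast this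
      omega
    · have : (m : ℝ) < ((⌊t⌋ + 2 : ℤ) : ℝ) := by push_cast; linarith
      have : m < ⌊t⌋ + 2 := by exact_mod_cast this
      omega
  refine hlf.continuous ?_ (fun m => isClosed_univ.prod isClosed_Icc) fun m => ?_
  · refine Set.eq_univ_of_forall fun p => Set.mem_iUnion.2 ⟨⌊p.2⌋, Set.mem_univ _, Int.floor_le _,
      (Int.lt_floor_add_one _).le⟩
  · let G : K × ℝ → MappingTorus φ := fun p =>
      Quot.mk _ ((φ ^ (-m)) p.1, Set.projIcc (0 : ℝ) 1 zero_le_one (p.2 - m))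
    have hG : Continuous G := by
      refine continuous_quot_mk.comp (Continuous.prodMk ?_ ?_)
      · exact (φ ^ (-m)).continuous.comp continuous_fst
      · exact continuous_projIcc.comp (by fun_prop)
    refine hG.continuousOn.congr ?_
    rintro ⟨x, t⟩ ⟨-, h1, h2⟩
    simp only at h1 h2
    have hmem : t - m ∈ Set.Icc (0 : ℝ) 1 := ⟨by linarith, by linarith⟩
    refine Eq.trans ?_ (mk_eq_cover φ ((φ ^ (-m)) x)
      (Set.projIcc (0 : ℝ) 1 zero_le_one (t - m))).symm
    rw [Set.projIcc_of_mem zero_le_one hmem, cover_eq_iff]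
    exact ⟨-m, by simp [sub_eq_add_neg]⟩

/-- The saturation of an open set is the union of its translates under the homeomorphisms of the
ℤ-action. -/
theorem isOpenMap_cover : IsOpenMap (cover φ) := by
  intro U hU
  have h : (Quot.mk (MappingTorusRel φ)) ⁻¹' (cover φ '' U) =
      ⋃ k : ℤ, {p : K × unitInterval | ((φ ^ k) p.1, (p.2 : ℝ) + k) ∈ U} := by
    ext ⟨x, t⟩
    simp only [Set.mem_preimage, Set.mem_iUnion, Set.mem_ofPred_eq]
    rw [mk_eq_cover]
    constructor
    · rintro ⟨p, hp, h⟩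
      obtain ⟨k, rfl⟩ := (cover_eq_iff φ).1 h.symm
      exact ⟨k, hp⟩
    · rintro ⟨k, hk⟩
      exact ⟨_, hk, cover_zpow_add φ k x t⟩
  refine isOpen_coinduced.2 ?_
  refine h ▸ isOpen_iUnion fun k => hU.preimage ?_
  exact ((φ ^ k).continuous.comp continuous_fst).prodMk (by fun_prop)

theorem isOpenQuotientMap_cover : IsOpenQuotientMap (cover φ) :=
  ⟨cover_surjective φ, continuous_cover φ, isOpenMap_cover φ⟩

instance [CompactSpace K] (φ : K → K) : CompactSpace (MappingTorus φ) :=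
  inferInstanceAs (CompactSpace (Quot (MappingTorusRel φ)))

/-- For an open quotient map it suffices that the equivalence relation is closed. It is the union of
the graphs of the iterates of (x, t) ↦ (φ x, t + 1), a locally finite family because the k-th graph
fixes the difference of the real coordinates to be k. -/
instance [T2Space K] : T2Space (MappingTorus φ) := by
  rw [t2Space_iff_of_isOpenQuotientMap (isOpenQuotientMap_cover φ)]
  let C : ℤ → Set ((K × ℝ) × (K × ℝ)) := fun k => {p | p.2 = ((φ ^ k) p.1.1, p.1.2 + k)}
  have hC : {q : (K × ℝ) × (K × ℝ) | cover φ q.1 = cover φ q.2} = ⋃ k, C k := by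
    ext q
    simp [C, cover_eq_iff]
  rw [hC]
  refine LocallyFinite.isClosed_iUnion ?_ fun k => ?_
  · rintro ⟨⟨x, s⟩, ⟨y, t⟩⟩
    refine ⟨{p | |p.2.2 - p.1.2 - (t - s)| < 1}, ?_, ?_⟩
    · refine IsOpen.mem_nhds (isOpen_lt (by fun_prop) continuous_const) ?_
      simp
    · refine (Set.finite_Icc (⌊t - s⌋ - 2) (⌊t - s⌋ + 2)).subset ?_
      rintro m ⟨⟨⟨x', s'⟩, ⟨y', t'⟩⟩, h, h'⟩
      simp only [C, Set.mem_ofPred_eq, Prod.mk.injEq] at h h'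
      have h5 := Int.floor_le (t - s)
      have h6 := Int.lt_floor_add_one (t - s)
      rw [abs_lt] at h'
      constructor
      · have : ((⌊t - s⌋ - 2 : ℤ) : ℝ) < m + 1 := by push_cast; linarith
        have : ⌊t - s⌋ - 2 < m + 1 := by exact_mod_cast this
        omega
      · have : (m : ℝ) < ((⌊t - s⌋ + 2 : ℤ) : ℝ) := by push_cast; linarith
        have : m < ⌊t - s⌋ + 2 := by exact_mod_cast this
        omega
  · refine isClosed_eq continuous_snd (Continuous.prodMk ?_ (by fun_prop))
    exact (φ ^ k).continuous.comp (continuous_fst.comp continuous_fst)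

end MappingTorus

/-! ### The Eisenstein lattice -/

theorem one_mem_eisensteinLattice : (1 : ℂ) ∈ eisensteinLattice :=
  AddSubgroup.subset_closure (by simp)

theorem zeta_eq : zeta = ⟨1 / 2, √3 / 2⟩ := by
  have e : (2 * Real.pi * Complex.I / 6 : ℂ) = ((Real.pi / 3 : ℝ) : ℂ) * Complex.I := by
    push_cast; ring
  rw [zeta, e, Complex.exp_mul_I, ← Complex.ofReal_cos, ← Complex.ofReal_sin,
    Real.cos_pi_div_three, Real.sin_pi_div_three]
  apply Complex.ext <;> simp

theorem norm_zeta : ‖zeta‖ = 1 := by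
  have e : (2 * Real.pi * Complex.I / 6 : ℂ) = ((Real.pi / 3 : ℝ) : ℂ) * Complex.I := by
    push_cast; ring
  rw [zeta, e, Complex.norm_exp_ofReal_mul_I]

theorem zeta_pow_six : zeta ^ 6 = 1 := by
  have h := zeta_sq
  calc zeta ^ 6 = (zeta * zeta) * (zeta * zeta) * (zeta * zeta) := by ring
    _ = 1 := by rw [h]; linear_combination (zeta - 2) * h

theorem isPrimitiveRoot_zeta : IsPrimitiveRoot zeta 6 := by
  have h := Complex.isPrimitiveRoot_exp 6 (by norm_num)
  rwa [Nat.cast_ofNat] at h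

theorem zeta_zpow_eq_one_iff {k : ℤ} : zeta ^ k = 1 ↔ 6 ∣ k := by
  exact_mod_cast isPrimitiveRoot_zeta.zpow_eq_one_iff_dvd k

theorem mem_eisensteinLattice_iff {z : ℂ} :
    z ∈ eisensteinLattice ↔ ∃ a b : ℤ, z = a + b * zeta := by
  rw [eisensteinLattice, AddSubgroup.mem_closure_pair]
  simp [eq_comm]

/-- The squared norm of a + bζ is the integer a² + ab + b², a positive definite form. -/
theorem eq_zero_of_mem_eisensteinLattice {z : ℂ} (hz : z ∈ eisensteinLattice) (h : ‖z‖ < 1) :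
    z = 0 := by
  obtain ⟨a, b, rfl⟩ := mem_eisensteinLattice_iff.1 hz
  have h3 : √3 * √3 = 3 := Real.mul_self_sqrt (by norm_num)
  have hn : Complex.normSq (a + b * zeta) = (a * a + a * b + b * b : ℤ) := by
    rw [zeta_eq, Complex.normSq_apply]
    simp
    linear_combination (b * b / 4 : ℝ) * h3
  have h1 : Complex.normSq (a + b * zeta) < 1 := by
    rw [Complex.normSq_eq_norm_sq]
    exact pow_lt_one₀ (norm_nonneg _) h two_ne_zero
  rw [hn] at h1
  have h2 : a * a + a * b + b * b < 1 := by exact_mod_cast h1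
  have h4 : b = 0 := by
    by_contra hb
    have : 1 ≤ b * b := mul_self_pos.2 hb
    nlinarith [mul_self_nonneg (2 * a + b)]
  subst h4
  have h5 : a = 0 := by
    by_contra ha
    have : 1 ≤ a * a := mul_self_pos.2 ha
    nlinarith
  simp [h5]

theorem exists_sub_mem_eisensteinLattice (z : ℂ) : ∃ w : ℂ, ‖w‖ ≤ 2 ∧ w - z ∈ eisensteinLattice := by
  have h3 : 0 < √3 := by positivity
  -- Real coordinates in the basis 1, ζ = 1/2 + i√3/2. Their fractional parts give a representative
  -- in the fundamental parallelogram.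
  let b : ℝ := z.im / (√3 / 2)
  let a : ℝ := z.re - b / 2
  have hz : z = a + b * zeta := by
    rw [zeta_eq]
    apply Complex.ext
    · simp only [a, Complex.add_re, Complex.ofReal_re, Complex.re_ofReal_mul]; ring
    · simp only [Complex.add_im, Complex.ofReal_im, Complex.im_ofReal_mul, b]; field_simp; ring
  refine ⟨(Int.fract a : ℝ) + (Int.fract b : ℝ) * zeta, ?_, ?_⟩
  · refine (norm_add_le _ _).trans ?_
    rw [norm_mul, norm_zeta, Complex.norm_real, Complex.norm_real, Real.norm_eq_abs,
      Real.norm_eq_abs, abs_of_nonneg (Int.fract_nonneg _), abs_of_nonneg (Int.fract_nonneg _)]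
    linarith [Int.fract_lt_one a, Int.fract_lt_one b]
  · refine mem_eisensteinLattice_iff.2 ⟨-⌊a⌋, -⌊b⌋, ?_⟩
    rw [hz, Int.fract, Int.fract]
    push_cast
    ring

/-! ### The torus -/

instance : T2Space (ℂ ⧸ eisensteinLattice) := by
  have : DiscreteTopology eisensteinLattice := by
    refine discreteTopology_of_isOpen_singleton_zero ?_
    refine Metric.isOpen_singleton_iff.2 ⟨1, one_pos, fun z hz => ?_⟩
    refine Subtype.ext (eq_zero_of_mem_eisensteinLattice z.2 ?_)
    simpa [dist_zero_right] using hz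
  have : IsClosed (eisensteinLattice : Set ℂ) := AddSubgroup.isClosed_of_discrete
  infer_instance

instance : CompactSpace (ℂ ⧸ eisensteinLattice) := by
  have h : (QuotientAddGroup.mk '' Metric.closedBall (0 : ℂ) 2 : Set (ℂ ⧸ eisensteinLattice)) =
      Set.univ := by
    refine Set.eq_univ_of_forall fun x => ?_
    induction x using QuotientAddGroup.induction_on with
    | H z =>
      obtain ⟨w, hw, hwz⟩ := exists_sub_mem_eisensteinLattice z
      refine ⟨w, by simpa using hw, ?_⟩
      rw [QuotientAddGroup.eq, neg_add_eq_sub, ← neg_sub]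
      exact neg_mem hwz
  exact ⟨h ▸ (isCompact_closedBall (0 : ℂ) 2).image continuous_quot_mk⟩

theorem torusProj_eq_iff {n : ℕ} {z w : EuclideanSpace ℂ (Fin n)} :
    torusProj n z = torusProj n w ↔ ∀ i, w i - z i ∈ eisensteinLattice := by
  simp only [torusProj, funext_iff, QuotientAddGroup.eq, neg_add_eq_sub]

theorem torusProj_add (n : ℕ) (z w : EuclideanSpace ℂ (Fin n)) :
    torusProj n (z + w) = torusProj n z + torusProj n w := rfl

theorem torusProj_zero (n : ℕ) : torusProj n 0 = 0 := rfl

theorem torusProj_sub (n : ℕ) (z w : EuclideanSpace ℂ (Fin n)) :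
    torusProj n (z - w) = torusProj n z - torusProj n w := rfl

theorem torusProj_surjective (n : ℕ) : Function.Surjective (torusProj n) := by
  intro x
  choose z hz using fun i => QuotientAddGroup.mk_surjective (x i)
  exact ⟨WithLp.toLp 2 z, funext hz⟩

theorem continuous_torusProj (n : ℕ) : Continuous (torusProj n) :=
  continuous_pi fun i => continuous_quot_mk.comp (by fun_prop)

theorem isOpenMap_torusProj (n : ℕ) : IsOpenMap (torusProj n) := by
  have h : IsOpenMap (Pi.map fun _ : Fin n => (QuotientAddGroup.mk : ℂ → ℂ ⧸ eisensteinLattice)) :=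
    IsOpenMap.piMap (fun _ => QuotientAddGroup.isOpenMap_coe)
      (Filter.Eventually.of_forall fun _ => QuotientAddGroup.mk_surjective)
  exact h.comp (PiLp.homeomorph 2 fun _ : Fin n => ℂ).isOpenMap

theorem eq_zero_of_torusProj_eq_zero {n : ℕ} {l : EuclideanSpace ℂ (Fin n)}
    (hl : torusProj n l = 0) (h : ‖l‖ < 1) : l = 0 := by
  ext i
  refine eq_zero_of_mem_eisensteinLattice ?_ ((PiLp.norm_apply_le l i).trans_lt h)
  exact (QuotientAddGroup.eq_zero_iff _).1 (congrFun hl i)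

theorem torusB_pow_torusProj (n k : ℕ) (z : EuclideanSpace ℂ (Fin n)) :
    (torusB n ^ k) (torusProj n z) = torusProj n (zeta ^ k • z) := by
  induction k with
  | zero => simp
  | succ k ih => rw [pow_succ', Homeomorph.mul_apply, ih, torusB_torusProj, smul_smul, pow_succ']

theorem torusB_zpow_torusProj (n : ℕ) (k : ℤ) (z : EuclideanSpace ℂ (Fin n)) :
    (torusB n ^ k) (torusProj n z) = torusProj n (zeta ^ k • z) := by
  obtain ⟨k, rfl | rfl⟩ := k.eq_nat_or_neg
  · rw [zpow_natCast, zpow_natCast, torusB_pow_torusProj]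
  · rw [zpow_neg, zpow_natCast, zpow_neg, zpow_natCast]
    refine (torusB n ^ k).toEquiv.symm_apply_eq.2 ?_
    change _ = (torusB n ^ k) _
    rw [torusB_pow_torusProj, smul_smul, mul_inv_cancel₀ (pow_ne_zero _ zeta_ne_zero), one_smul]

theorem orderOf_torusB {n : ℕ} (hn : 1 ≤ n) : orderOf (torusB n) = 6 := by
  refine (orderOf_eq_iff (by norm_num)).2 ⟨?_, fun m hm h0 h => ?_⟩
  · ext1 x
    obtain ⟨z, rfl⟩ := torusProj_surjective n x
    rw [torusB_pow_torusProj, zeta_pow_six, one_smul]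
    rfl
  · let i : Fin n := ⟨0, hn⟩
    -- With coordinate 1/3 the displacement (1 - ζᵐ)/3 has norm at most 2/3, so it lies in the
    -- lattice only if it vanishes.
    let z : EuclideanSpace ℂ (Fin n) := EuclideanSpace.single i (1 / 3)
    have h1 := DFunLike.congr_fun h (torusProj n z)
    rw [torusB_pow_torusProj, Homeomorph.one_apply, torusProj_eq_iff] at h1
    have h2 := eq_zero_of_mem_eisensteinLattice (h1 i) ?_
    · refine isPrimitiveRoot_zeta.pow_ne_one_of_pos_of_lt h0.ne' hm ?_
      simp [z] at h2
      linear_combination -3 * h2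
    · have : z i - (zeta ^ m • z) i = (1 - zeta ^ m) / 3 := by simp [z]; ring
      rw [this, norm_div]
      have h3 : ‖(1 : ℂ) - zeta ^ m‖ ≤ 2 := by
        refine (norm_sub_le _ _).trans ?_
        rw [norm_pow, norm_zeta, one_pow, norm_one]; norm_num
      have h4 : ‖(3 : ℂ)‖ = 3 := by simp
      rw [h4]
      linarith

theorem isDiscrete_ker_of_torusProj (n : ℕ) :
    IsDiscrete {l : EuclideanSpace ℂ (Fin n) | torusProj n l = 0} := by
  refine ⟨discreteTopology_subtype_iff'.2 fun l hl => ?_⟩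
  refine ⟨Metric.ball l 1, Metric.isOpen_ball, ?_⟩
  ext m
  simp only [Set.mem_inter_iff, mem_ball_iff_norm, Set.mem_ofPred_eq, Set.mem_singleton_iff]
  constructor
  · rintro ⟨h, hm⟩
    refine sub_eq_zero.1 (eq_zero_of_torusProj_eq_zero ?_ h)
    rw [torusProj_sub, hm, hl, sub_zero]
  · rintro rfl
    simpa using hl

theorem isOpenQuotientMap_torusProj (n : ℕ) : IsOpenQuotientMap (torusProj n) :=
  ⟨torusProj_surjective n, continuous_torusProj n, isOpenMap_torusProj n⟩

theorem isLocalHomeomorph_torusProj (n : ℕ) : IsLocalHomeomorph (torusProj n) := by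
  let f : EuclideanSpace ℂ (Fin n) →+ Torus n :=
    { toFun := torusProj n, map_zero' := rfl, map_add' := torusProj_add n }
  have hf : Topology.IsQuotientMap f := (isOpenQuotientMap_torusProj n).isQuotientMap
  exact (hf.isAddQuotientCoveringMap_of_isDiscrete_ker_addMonoidHom
    (isDiscrete_ker_of_torusProj n)).isCoveringMap.isLocalHomeomorph

/-! ### The universal covering of `T²ⁿ_B` and its group of deck transformations -/

/-- The universal covering map `ℂⁿ × ℝ → T²ⁿ_B`. -/
def torusBProj (n : ℕ) (p : EuclideanSpace ℂ (Fin n) × ℝ) : TorusB n :=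
  MappingTorus.cover (torusB n) (torusProj n p.1, p.2)

theorem isOpenQuotientMap_torusBProj (n : ℕ) : IsOpenQuotientMap (torusBProj n) :=
  (MappingTorus.isOpenQuotientMap_cover (torusB n)).comp
    ((isOpenQuotientMap_torusProj n).prodMap IsOpenQuotientMap.id)

theorem torusBProj_eq_iff {n : ℕ} {p p' : EuclideanSpace ℂ (Fin n) × ℝ} :
    torusBProj n p = torusBProj n p' ↔ ∃ (k : ℤ) (l : EuclideanSpace ℂ (Fin n)),
      torusProj n l = 0 ∧ p' = (zeta ^ k • p.1 + l, p.2 + k) := by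
  rw [torusBProj, torusBProj, MappingTorus.cover_eq_iff]
  refine exists_congr fun k => ?_
  simp only [torusB_zpow_torusProj, Prod.ext_iff]
  constructor
  · rintro ⟨h1, h2⟩
    exact ⟨p'.1 - zeta ^ k • p.1, by rw [torusProj_sub, h1, sub_self], by simp, h2⟩
  · rintro ⟨l, hl, h1, h2⟩
    exact ⟨by rw [h1, torusProj_add, hl, add_zero], h2⟩

/-- The map `(z, t) ↦ (ζᵏ z + l, t + k)`. -/
def deckMap {n : ℕ} (k : ℤ) (l : EuclideanSpace ℂ (Fin n)) :
    Equiv.Perm (EuclideanSpace ℂ (Fin n) × ℝ) where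
  toFun p := (zeta ^ k • p.1 + l, p.2 + k)
  invFun p := (zeta ^ (-k) • (p.1 - l), p.2 - k)
  left_inv p := by
    ext1
    · simp [smul_smul, inv_mul_cancel₀ (zpow_ne_zero k zeta_ne_zero)]
    · simp
  right_inv p := by
    ext1
    · simp [smul_smul, mul_inv_cancel₀ (zpow_ne_zero k zeta_ne_zero)]
    · simp

theorem deckMap_apply {n : ℕ} (k : ℤ) (l : EuclideanSpace ℂ (Fin n))
    (p : EuclideanSpace ℂ (Fin n) × ℝ) : deckMap k l p = (zeta ^ k • p.1 + l, p.2 + k) := rfl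

theorem deckMap_mul {n : ℕ} (j k : ℤ) (l m : EuclideanSpace ℂ (Fin n)) :
    deckMap j l * deckMap k m = deckMap (j + k) (zeta ^ j • m + l) := by
  ext1 p
  rw [Equiv.Perm.mul_apply, deckMap_apply, deckMap_apply, deckMap_apply]
  refine Prod.ext ?_ ?_
  · simp only
    rw [smul_add, smul_smul, zpow_add₀ zeta_ne_zero, add_assoc]
  · push_cast
    ring

theorem deckMap_zero (n : ℕ) : deckMap 0 (0 : EuclideanSpace ℂ (Fin n)) = 1 := by
  ext1 p
  simp [deckMap_apply]

theorem deckMap_inv {n : ℕ} (k : ℤ) (l : EuclideanSpace ℂ (Fin n)) :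
    (deckMap k l)⁻¹ = deckMap (-k) (-(zeta ^ (-k) • l)) := by
  rw [inv_eq_iff_mul_eq_one, deckMap_mul, ← deckMap_zero]
  congr 1
  · ring
  · rw [smul_neg, smul_smul, ← zpow_add₀ zeta_ne_zero]
    simp

theorem deckMap_injective {n : ℕ} {j k : ℤ} {l m : EuclideanSpace ℂ (Fin n)}
    (h : deckMap j l = deckMap k m) : j = k ∧ l = m := by
  have h0 := Equiv.congr_fun h (0, 0)
  simpa [deckMap_apply, and_comm] using h0

theorem torusProj_zpow_smul {n : ℕ} {l : EuclideanSpace ℂ (Fin n)} (hl : torusProj n l = 0)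
    (k : ℤ) : torusProj n (zeta ^ k • l) = 0 := by
  rw [← torusB_zpow_torusProj, hl, ← torusProj_zero, torusB_zpow_torusProj, smul_zero]

theorem torusProj_neg_eq_zero {n : ℕ} {l : EuclideanSpace ℂ (Fin n)} (hl : torusProj n l = 0) :
    torusProj n (-l) = 0 := by
  rw [← zero_sub, torusProj_sub, hl, torusProj_zero, sub_zero]

/-- The group of deck transformations of `ℂⁿ × ℝ → T²ⁿ_B`. -/
def deckGroup (n : ℕ) : Subgroup (Equiv.Perm (EuclideanSpace ℂ (Fin n) × ℝ)) where
  carrier := {g | ∃ (k : ℤ) (l : EuclideanSpace ℂ (Fin n)), torusProj n l = 0 ∧ g = deckMap k l}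
  one_mem' := ⟨0, 0, rfl, (deckMap_zero n).symm⟩
  mul_mem' := by
    rintro _ _ ⟨j, l, hl, rfl⟩ ⟨k, m, hm, rfl⟩
    refine ⟨_, _, ?_, deckMap_mul j k l m⟩
    rw [torusProj_add, torusProj_zpow_smul hm, hl, zero_add]
  inv_mem' := by
    rintro _ ⟨k, l, hl, rfl⟩
    exact ⟨_, _, torusProj_neg_eq_zero (torusProj_zpow_smul hl (-k)), deckMap_inv k l⟩

namespace deckGroup

variable {n : ℕ}

/-- The deck transformation `(z, t) ↦ (ζᵏ z + l, t + k)`. -/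
def mk (k : ℤ) (l : EuclideanSpace ℂ (Fin n)) (hl : torusProj n l = 0) : deckGroup n :=
  ⟨deckMap k l, k, l, hl, rfl⟩

theorem exists_eq_mk (g : deckGroup n) : ∃ k l hl, g = mk k l hl := by
  obtain ⟨_, k, l, hl, rfl⟩ := g
  exact ⟨k, l, hl, rfl⟩

theorem mk_smul (k : ℤ) (l : EuclideanSpace ℂ (Fin n)) (hl : torusProj n l = 0)
    (p : EuclideanSpace ℂ (Fin n) × ℝ) : mk k l hl • p = (zeta ^ k • p.1 + l, p.2 + k) := rfl

theorem mk_mul_mk (j k : ℤ) (l m : EuclideanSpace ℂ (Fin n)) (hl : torusProj n l = 0)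
    (hm : torusProj n m = 0) :
    mk j l hl * mk k m hm = mk (j + k) (zeta ^ j • m + l)
      (by rw [torusProj_add, torusProj_zpow_smul hm, hl, zero_add]) :=
  Subtype.ext (deckMap_mul j k l m)

theorem mk_inj {j k : ℤ} {l m : EuclideanSpace ℂ (Fin n)} {hl : torusProj n l = 0}
    {hm : torusProj n m = 0} : mk j l hl = mk k m hm ↔ j = k ∧ l = m :=
  ⟨fun h => deckMap_injective (congrArg Subtype.val h), by rintro ⟨rfl, rfl⟩; rfl⟩

theorem one_eq_mk : (1 : deckGroup n) = mk 0 0 (torusProj_zero n) := Subtype.ext (deckMap_zero n).symm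

variable (n) in
/-- The deck transformation `(z, t) ↦ (ζ z, t + 1)`. -/
def shift : deckGroup n := mk 1 0 (torusProj_zero n)

theorem shift_zpow (k : ℤ) : shift n ^ k = mk k 0 (torusProj_zero n) := by
  have h : ∀ j : ℤ, shift n * mk j 0 (torusProj_zero n) = mk (1 + j) 0 (torusProj_zero n) := fun j => by
    rw [shift, mk_mul_mk, mk_inj]
    simp
  induction k with
  | zero => rw [zpow_zero, one_eq_mk]
  | succ k ih => rw [add_comm, zpow_one_add, ih, h]
  | pred k ih =>
    rw [← mul_right_inj (shift n), ← zpow_one_add, h, show (1 : ℤ) + (-k - 1) = -k by ring, ih]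

theorem mk_eq_mul_shift_zpow (k : ℤ) (l : EuclideanSpace ℂ (Fin n)) (hl : torusProj n l = 0) :
    mk k l hl = mk 0 l hl * shift n ^ k := by
  rw [shift_zpow, mk_mul_mk, mk_inj]
  simp

variable (n) in
/-- The homomorphism sending `(z, t) ↦ (ζᵏ z + l, t + k)` to `k`. -/
def degree : deckGroup n →* Multiplicative ℝ where
  toFun g := .ofAdd (g • (0 : EuclideanSpace ℂ (Fin n) × ℝ)).2
  map_one' := by simp
  map_mul' g h := by
    obtain ⟨j, l, hl, rfl⟩ := exists_eq_mk g
    obtain ⟨k, m, hm, rfl⟩ := exists_eq_mk h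
    rw [mk_mul_mk, mk_smul, mk_smul, mk_smul, ← ofAdd_add]
    simp

theorem degree_mk (k : ℤ) (l : EuclideanSpace ℂ (Fin n)) (hl : torusProj n l = 0) :
    degree n (mk k l hl) = .ofAdd (k : ℝ) := by
  change Multiplicative.ofAdd (mk k l hl • (0 : EuclideanSpace ℂ (Fin n) × ℝ)).2 = _
  rw [mk_smul]
  simp

/-- So ζ - 1 maps Λ bijectively to itself. Both the abelianization and the centre of the deck group
depend on this. -/
theorem zeta_sub_one : zeta - 1 = zeta ^ 2 := by rw [sq, zeta_sq]

-- The commutator of the shift with translation by m is translation by (ζ - 1)m = ζ²m, whence the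
-- choice m = ζ⁻²l.
open scoped commutatorElement in
theorem mk_zero_eq_commutator (l : EuclideanSpace ℂ (Fin n)) (hl : torusProj n l = 0) :
    mk 0 l hl = ⁅shift n, mk 0 (zeta ^ (-2 : ℤ) • l) (torusProj_zpow_smul hl _)⁆ := by
  rw [eq_comm, commutatorElement_def, mul_inv_eq_iff_eq_mul, mul_inv_eq_iff_eq_mul, shift,
    mk_mul_mk, mk_mul_mk, mk_mul_mk, mk_inj]
  refine ⟨by simp, ?_⟩
  have h : zeta ^ 2 ≠ 0 := pow_ne_zero _ zeta_ne_zero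
  have h2 : zeta * (zeta ^ 2)⁻¹ = (zeta ^ 2)⁻¹ + 1 := by
    rw [mul_inv_eq_iff_eq_mul₀ h, add_mul, inv_mul_cancel₀ h, one_mul, ← zeta_sub_one]
    ring
  simp only [smul_zero, add_zero, zero_add, smul_smul, zpow_neg, zpow_ofNat, pow_one, pow_zero,
    one_mul, h2, add_smul, one_smul]

/-- The kernel of the degree consists of translations, so the group is abelian by abelian. -/
instance : Group.IsSolvable (deckGroup n) := by
  have hc : ∀ g h : (degree n).ker, g * h = h * g := by
    rintro ⟨g, hg⟩ ⟨h, hh⟩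
    obtain ⟨j, l, hl, rfl⟩ := exists_eq_mk g
    obtain ⟨k, m, hm, rfl⟩ := exists_eq_mk h
    rw [MonoidHom.mem_ker, degree_mk, ofAdd_eq_one, Int.cast_eq_zero] at hg hh
    subst hg hh
    ext1
    change mk 0 l hl * mk 0 m hm = mk 0 m hm * mk 0 l hl
    rw [mk_mul_mk, mk_mul_mk, mk_inj]
    simp [add_comm]
  have : Group.IsSolvable (degree n).ker := Group.isSolvable_of_comm hc
  exact Group.isSolvable_of_ker_le_range (degree n).ker.subtype (degree n) (by simp)

variable (n) in
/-- The abelianization of the group of deck transformations is infinite cyclic. -/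
def abelianizationEquiv : ℤ ≃+ Additive (Abelianization (deckGroup n)) := by
  refine AddEquiv.ofBijective
    (zmultiplesHom _ (Additive.ofMul (Abelianization.of (shift n)))) ⟨?_, ?_⟩
  · refine (injective_iff_map_eq_zero _).2 fun k hk => ?_
    have h1 : Abelianization.of (shift n) ^ k = 1 := hk
    have h2 : Abelianization.lift (degree n) (Abelianization.of (shift n) ^ k) = 1 := by
      rw [h1, map_one]
    rw [← map_zpow, Abelianization.lift_apply_of, shift_zpow, degree_mk, ofAdd_eq_one,
      Int.cast_eq_zero] at h2
    exact h2
  · intro a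
    obtain ⟨g, hg⟩ := Quot.exists_rep a.toMul
    obtain ⟨k, l, hl, rfl⟩ := exists_eq_mk g
    refine ⟨k, ?_⟩
    change Abelianization.of (shift n) ^ k = a.toMul
    rw [← hg, Abelianization.mk_eq_of, mk_eq_mul_shift_zpow, map_mul, mk_zero_eq_commutator,
      map_commutatorElement, commutatorElement_eq_one_iff_mul_comm.2 (mul_comm _ _), one_mul,
      map_zpow]

/-- Commuting with the shift gives (ζ - 1)l = 0, so l = 0. Commuting with one non-zero translation
then gives ζᵏ = 1, so 6 divides k. -/
theorem exists_eq_shift_zpow_of_commute {γ : deckGroup n} (hn : 1 ≤ n)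
    (h : ∀ δ : deckGroup n, γ * δ = δ * γ) : ∃ m : ℤ, γ = shift n ^ (6 * m) := by
  obtain ⟨k, l, hl, rfl⟩ := exists_eq_mk γ
  have h1 := h (shift n)
  rw [shift, mk_mul_mk, mk_mul_mk, mk_inj] at h1
  have h2 : (zeta - 1) • l = 0 := by
    have := h1.2
    simp only [smul_zero, zero_add, zpow_one, add_zero] at this
    rw [sub_smul, one_smul, ← this, sub_self]
  rw [zeta_sub_one] at h2
  obtain rfl : l = 0 := (smul_eq_zero.1 h2).resolve_left (pow_ne_zero _ zeta_ne_zero)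
  let i : Fin n := ⟨0, hn⟩
  have he : torusProj n (EuclideanSpace.single i 1) = 0 := by
    rw [← torusProj_zero, eq_comm, torusProj_eq_iff]
    intro j
    by_cases hj : j = i
    · subst hj
      simpa using one_mem_eisensteinLattice
    · simp [hj, zero_mem]
  have h3 := h (mk 0 _ he)
  rw [mk_mul_mk, mk_mul_mk, mk_inj] at h3
  have h4 : zeta ^ k = 1 := by
    have := congrArg (fun v : EuclideanSpace ℂ (Fin n) => v i) h3.2
    simpa using this
  obtain ⟨m, rfl⟩ := zeta_zpow_eq_one_iff.1 h4
  exact ⟨m, (shift_zpow _).symm⟩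

end deckGroup

theorem isQuotientCoveringMap_torusBProj (n : ℕ) :
    IsQuotientCoveringMap (torusBProj n) (deckGroup n) where
  toIsQuotientMap := (isOpenQuotientMap_torusBProj n).isQuotientMap
  continuous_const_smul g := by
    obtain ⟨k, l, hl, rfl⟩ := deckGroup.exists_eq_mk g
    simp only [deckGroup.mk_smul]
    fun_prop
  apply_eq_iff_mem_orbit {p p'} := by
    rw [eq_comm, torusBProj_eq_iff, MulAction.mem_orbit_iff]
    constructor
    · rintro ⟨k, l, hl, rfl⟩
      exact ⟨deckGroup.mk k l hl, rfl⟩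
    · rintro ⟨g, rfl⟩
      obtain ⟨k, l, hl, rfl⟩ := deckGroup.exists_eq_mk g
      exact ⟨k, l, hl, rfl⟩
  disjoint p := by
    -- Radius 1/2 makes g move some point r by less than 1. Then |k| < 1 forces k = 0, and g is a
    -- translation by a lattice vector of norm less than 1, that is, by zero.
    refine ⟨Metric.ball p (1 / 2), Metric.ball_mem_nhds _ (by norm_num), fun g hg => ?_⟩
    obtain ⟨_, ⟨r, hr, rfl⟩, hr'⟩ := hg
    obtain ⟨k, l, hl, rfl⟩ := deckGroup.exists_eq_mk g
    have hd : dist (deckGroup.mk k l hl • r) r < 1 := by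
      have := dist_triangle_right (deckGroup.mk k l hl • r) r p
      rw [Metric.mem_ball] at hr
      have hr'' : dist (deckGroup.mk k l hl • r) p < 1 / 2 := hr'
      linarith
    rw [deckGroup.mk_smul, Prod.dist_eq, max_lt_iff] at hd
    obtain ⟨h1, h2⟩ := hd
    have hk : k = 0 := by
      rw [Real.dist_eq, add_sub_cancel_left] at h2
      have : |k| < 1 := by exact_mod_cast h2
      rwa [Int.abs_lt_one_iff] at this
    subst hk
    have hl0 : l = 0 := by
      refine eq_zero_of_torusProj_eq_zero hl ?_
      simpa [dist_eq_norm] using h1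
    subst hl0
    exact deckGroup.one_eq_mk.symm

theorem isSolvable_fundamentalGroup_torusB (n : ℕ) (x : TorusB n) :
    Group.IsSolvable (FundamentalGroup (TorusB n) x) := by
  have h := isQuotientCoveringMap_torusBProj n
  obtain ⟨e, he⟩ := h.surjective x
  -- The fundamental group is identified with the opposite of the deck group, and inversion undoes
  -- the reversal.
  let f : FundamentalGroup (TorusB n) x ≃* deckGroup n :=
    (h.fundamentalGroupEquiv (⟨e, he⟩ : torusBProj n ⁻¹' {x})).trans (MulEquiv.inv' _).symm
  exact Group.isSolvable_of_isSolvable_injective (f := f.toMonoidHom) f.injective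

/-! ### Finite coverings of mapping tori -/

theorem IsLocalHomeomorph.of_comp_surjective {X Y Z : Type*} [TopologicalSpace X]
    [TopologicalSpace Y] [TopologicalSpace Z] {g : Y → Z} {f : X → Y}
    (hgf : IsLocalHomeomorph (g ∘ f)) (hf : IsLocalHomeomorph f) (hs : Function.Surjective f) :
    IsLocalHomeomorph g := by
  refine IsLocalHomeomorph.mk g fun y => ?_
  obtain ⟨x, rfl⟩ := hs y
  obtain ⟨e, hx, rfl⟩ := hf x
  obtain ⟨e', hx', he'⟩ := hgf x
  refine ⟨e.symm.trans e', ?_, ?_⟩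
  · simp [hx, hx']
  · intro y hy
    have hy1 : y ∈ e.target := by
      simpa using (e.symm.trans_source e' ▸ hy).1
    have h := congrFun he' (e.symm y)
    simp only [Function.comp_apply, e.right_inv hy1] at h
    simp [h]

theorem IsLocalHomeomorph.prodMap' {X Y Z W : Type*} [TopologicalSpace X] [TopologicalSpace Y]
    [TopologicalSpace Z] [TopologicalSpace W] {f : X → Y} {g : Z → W} (hf : IsLocalHomeomorph f)
    (hg : IsLocalHomeomorph g) : IsLocalHomeomorph (Prod.map f g) := by
  refine IsLocalHomeomorph.mk _ fun p => ?_
  obtain ⟨e, he, rfl⟩ := hf p.1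
  obtain ⟨e', he', rfl⟩ := hg p.2
  exact ⟨e.prod e', ⟨he, he'⟩, fun _ _ => rfl⟩

namespace MappingTorus

variable {K : Type*} [TopologicalSpace K] (φ : K ≃ₜ K)

/-- The map `K × S¹ → K_φ`, `(x, e^{2πis}) ↦ [x, N s]`, for `φ` with `φᴺ = 1`. -/
def finiteCover (N : ℕ) (p : K × Circle) : MappingTorus φ :=
  cover φ (p.1, N * (Complex.arg p.2 / (2 * Real.pi)))

variable {φ} {N : ℕ}

theorem finiteCover_exp (h : φ ^ N = 1) (x : K) (s : ℝ) :
    finiteCover φ N (x, Circle.exp (2 * Real.pi * s)) = cover φ (x, N * s) := by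
  obtain ⟨m, hm⟩ := Circle.exp_eq_exp.1 (Circle.exp_arg (Circle.exp (2 * Real.pi * s)))
  rw [finiteCover, hm, eq_comm, cover_eq_iff]
  -- The principal argument differs from 2πs by 2πm, which moves the real coordinate by Nm; this is
  -- a deck transformation acting trivially on K because φᴺ = 1.
  refine ⟨N * m, ?_⟩
  rw [zpow_mul, zpow_natCast, h, one_zpow]
  refine Prod.ext rfl ?_
  have := Real.pi_ne_zero
  push_cast
  field_simp

theorem exists_exp_eq (w : Circle) : ∃ s : ℝ, Circle.exp (2 * Real.pi * s) = w := by
  refine ⟨Complex.arg w / (2 * Real.pi), ?_⟩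
  rw [mul_div_cancel₀ _ (by positivity), Circle.exp_arg]

theorem exp_two_pi_eq_iff {s t : ℝ} :
    Circle.exp (2 * Real.pi * s) = Circle.exp (2 * Real.pi * t) ↔ ∃ m : ℤ, s = t + m := by
  rw [Circle.exp_eq_exp]
  refine exists_congr fun m => ?_
  have := Real.pi_pos
  constructor
  · intro h
    have : 2 * Real.pi * s = 2 * Real.pi * (t + m) := by rw [h]; ring
    exact mul_left_cancel₀ (by positivity) this
  · rintro rfl
    ring

theorem isLocalHomeomorph_finiteCover (hN : N ≠ 0) (h : φ ^ N = 1)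
    (hc : IsLocalHomeomorph (cover φ)) : IsLocalHomeomorph (finiteCover φ N) := by
  let f : K × ℝ → K × Circle := Prod.map id fun s => Circle.exp (2 * Real.pi * s)
  have hmul : ∀ {c : ℝ}, c ≠ 0 → IsLocalHomeomorph fun s : ℝ => c * s := fun hc =>
    (Homeomorph.mulLeft₀ _ hc).isLocalHomeomorph
  have hf : IsLocalHomeomorph f := (Homeomorph.refl K).isLocalHomeomorph.prodMap'
    (isLocalHomeomorph_circleExp.comp (hmul (by positivity)))
  have hs : Function.Surjective f := by
    rintro ⟨x, w⟩
    obtain ⟨s, rfl⟩ := exists_exp_eq w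
    exact ⟨(x, s), rfl⟩
  refine IsLocalHomeomorph.of_comp_surjective (f := f) ?_ hf hs
  have he : finiteCover φ N ∘ f = cover φ ∘ Prod.map id fun s => (N : ℝ) * s :=
    funext fun p => finiteCover_exp h p.1 p.2
  rw [he]
  exact hc.comp ((Homeomorph.refl K).isLocalHomeomorph.prodMap' (hmul (by exact_mod_cast hN)))

theorem card_fiber_finiteCover (hN : N ≠ 0) (h : φ ^ N = 1) (y : MappingTorus φ) :
    Nat.card (finiteCover φ N ⁻¹' {y}) = N := by
  obtain ⟨⟨x, t⟩, rfl⟩ := cover_surjective φ y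
  have hN' : (N : ℝ) ≠ 0 := by exact_mod_cast hN
  have key : ∀ k : ℤ, finiteCover φ N ((φ ^ k) x, Circle.exp (2 * Real.pi * ((t + k) / N))) =
      cover φ (x, t) := fun k => by
    rw [finiteCover_exp h, mul_div_cancel₀ _ hN', cover_zpow_add]
  -- The orbit representatives (φᵏx, t + k) give all the points of the fibre, and two of them give
  -- the same point exactly when k agrees modulo N.
  let F : Fin N → finiteCover φ N ⁻¹' {cover φ (x, t)} := fun k => ⟨_, key (k : ℕ)⟩
  have hF : Function.Bijective F := by
    constructor
    · intro j k hjk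
      have h1 := congrArg (fun p => (Subtype.val p).2) hjk
      obtain ⟨m, hm⟩ := exp_two_pi_eq_iff.1 h1
      have h2 : ((j : ℤ) : ℝ) = ((k + N * m : ℤ) : ℝ) := by
        field_simp at hm
        push_cast at hm ⊢
        linarith
      have h3 : ((j : ℕ) : ℤ) = k + N * m := by exact_mod_cast h2
      have h4 := congrArg (· % (N : ℤ)) h3
      simp only [Int.add_mul_emod_self_left] at h4
      rw [Int.emod_eq_of_lt (by positivity) (by exact_mod_cast j.2),
        Int.emod_eq_of_lt (by positivity) (by exact_mod_cast k.2)] at h4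
      exact Fin.ext (by exact_mod_cast h4)
    · rintro ⟨⟨x', w⟩, hw⟩
      obtain ⟨s, rfl⟩ := exists_exp_eq w
      rw [Set.mem_preimage, Set.mem_singleton_iff, finiteCover_exp h] at hw
      obtain ⟨k, hk⟩ := (cover_eq_iff φ).1 hw.symm
      obtain ⟨rfl, hs⟩ := Prod.ext_iff.1 hk
      have hpos : (0 : ℤ) < N := by positivity
      have hr := Int.emod_nonneg k hpos.ne'
      refine ⟨⟨(k % N).toNat, by have := Int.emod_lt_of_pos k hpos; omega⟩, ?_⟩
      have hc : (((k % N).toNat : ℕ) : ℤ) = k % N := Int.toNat_of_nonneg hr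
      refine Subtype.ext (Prod.ext ?_ ?_)
      · change (φ ^ (((k % N).toNat : ℕ) : ℤ)) x = (φ ^ k) x
        rw [hc]
        conv_rhs => rw [← Int.emod_add_mul_ediv k N, zpow_add, zpow_mul, zpow_natCast, h, one_zpow,
          mul_one]
      · change Circle.exp (2 * Real.pi * ((t + ((((k % N).toNat : ℕ) : ℤ) : ℝ)) / N)) = _
        rw [hc]
        refine exp_two_pi_eq_iff.2 ⟨-(k / N), ?_⟩
        have hk' : (k : ℝ) = (k % N : ℤ) + N * (k / N : ℤ) := by
          exact_mod_cast (Int.emod_add_mul_ediv k N).symm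
        have hs' : (N : ℝ) * s = t + k := hs
        push_cast
        field_simp
        linear_combination -hk' - hs'
  rw [← Nat.card_eq_of_bijective F hF, Nat.card_fin]

end MappingTorus

theorem isLocalHomeomorph_cover_torusB (n : ℕ) :
    IsLocalHomeomorph (MappingTorus.cover (torusB n)) := by
  refine IsLocalHomeomorph.of_comp_surjective (f := Prod.map (torusProj n) id)
    (isQuotientCoveringMap_torusBProj n).isCoveringMap.isLocalHomeomorph
    ((isLocalHomeomorph_torusProj n).prodMap' (Homeomorph.refl ℝ).isLocalHomeomorph)
    ((torusProj_surjective n).prodMap Function.surjective_id)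

theorem exists_six_sheeted_covering {n : ℕ} (hn : 1 ≤ n) :
    ∃ p : Torus n × Circle → TorusB n,
      IsCoveringMap p ∧ ∀ y : TorusB n, Nat.card (p ⁻¹' {y}) = 6 := by
  have h6 : torusB n ^ 6 = 1 := by rw [← orderOf_torusB hn, pow_orderOf_eq_one]
  -- A local homeomorphism from a compact space to a Hausdorff space is a covering map here.
  refine ⟨MappingTorus.finiteCover (torusB n) 6, isLocalHomeomorph_iff_isCoveringMap.1 ?_,
    MappingTorus.card_fiber_finiteCover (by norm_num) h6⟩
  exact MappingTorus.isLocalHomeomorph_finiteCover (by norm_num) h6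
    (isLocalHomeomorph_cover_torusB n)

/-! ### `T²ⁿ_B` is not a product with a circle -/

/-- If the base of a simply connected covering with group `G` is a product `K × S¹`, then some
central element of `G` is sent to `1` by some homomorphism `G → ℤ`, here scaled by `2π`. -/
theorem IsQuotientCoveringMap.exists_central_of_homeomorph_prod_circle {Y X K G : Type*}
    [TopologicalSpace Y] [TopologicalSpace X] [TopologicalSpace K] [Group G] [MulAction G Y]
    [SimplyConnectedSpace Y] [LocallyPathConnectedSpace Y] {q : Y → X}
    (hq : IsQuotientCoveringMap q G) (h : X ≃ₜ K × Circle) :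
    ∃ (γ : G) (ρ : G →* Multiplicative ℝ), (∀ δ, γ * δ = δ * γ) ∧
      ρ γ = .ofAdd (2 * Real.pi) ∧ ∀ δ, ∃ m : ℤ, ρ δ = .ofAdd (m * (2 * Real.pi)) := by
  have hcov := hq.isCoveringMap
  have hfree := hq.isCancelSMul
  have hcont : ∀ g : G, Continuous fun y : Y => g • y :=
    hq.toContinuousConstSMul.continuous_const_smul
  obtain ⟨y₀⟩ : Nonempty Y := inferInstance
  have hexp := Circle.isCoveringMap_exp
  -- the lift of the circle coordinate
  let f : C(Y, Circle) := ⟨fun y => (h (q y)).2, by have := hq.continuous; fun_prop⟩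
  obtain ⟨s₀, hs₀⟩ : ∃ s, Circle.exp s = f y₀ := ⟨_, Circle.exp_arg _⟩
  obtain ⟨F, ⟨-, hF⟩, -⟩ := hexp.existsUnique_continuousMap_lifts f y₀ s₀ hs₀
  have hFf : ∀ y, Circle.exp (F y) = (h (q y)).2 := congrFun hF
  -- the lift of the rotation
  let H : C(unitInterval × Y, X) :=
    ⟨fun p => h.symm ((h (q p.2)).1, Circle.exp (2 * Real.pi * p.1) * (h (q p.2)).2), by
      have := hq.continuous
      fun_prop⟩
  have H0 : ∀ y, H (0, y) = q (ContinuousMap.id Y y) := fun y => by simp [H]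
  let Θ := hcov.liftHomotopy H (ContinuousMap.id Y) H0
  have hΘ : ∀ t y, q (Θ (t, y)) = H (t, y) := fun t y =>
    congrFun (hcov.liftHomotopy_lifts H (ContinuousMap.id Y) H0) (t, y)
  have hΘ0 : ∀ y, Θ (0, y) = y := hcov.liftHomotopy_zero H (ContinuousMap.id Y) H0
  have hΘ1 : ∀ y, q (Θ (1, y)) = q y := fun y => by rw [hΘ]; simp [H]
  -- Both sides end lifts of the same rotation path starting at δ • y, so uniqueness of lifts makes
  -- the lifted rotation equivariant.
  have hΘδ : ∀ (δ : G) y, Θ (1, δ • y) = δ • Θ (1, y) := fun δ y => by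
    have := hcov.eq_of_comp_eq (g₁ := fun t : unitInterval => Θ (t, δ • y))
      (g₂ := fun t => δ • Θ (t, y)) (by fun_prop) ((hcont δ).comp (by fun_prop))
      (funext fun t => by simp [hΘ, hq.map_smul, H]) 0 (by simp only [hΘ0])
    exact congrFun this 1
  -- Along the lifted rotation, F and F y + 2πt lift the same path in the circle.
  have hFΘ : ∀ y, F (Θ (1, y)) = F y + 2 * Real.pi := fun y => by
    have := hexp.eq_of_comp_eq (g₁ := fun t : unitInterval => F (Θ (t, y)))
      (g₂ := fun t => F y + 2 * Real.pi * t) (by fun_prop) (by fun_prop)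
      (funext fun t => by
        simp only [Function.comp_apply, hFf, hΘ, Circle.exp_add]
        simp [H, mul_comm]) 0 (by simp only [hΘ0]; simp)
    simpa using congrFun this 1
  obtain ⟨γ, hγ⟩ := hq.apply_eq_iff_mem_orbit.1 (hΘ1 y₀)
  -- F and its composite with δ lift the same circle-valued map, so they differ by a constant; this
  -- makes δ ↦ F (δ • y₀) - F y₀ additive.
  have hFδ : ∀ (δ : G) y, F (δ • y) = F y + (F (δ • y₀) - F y₀) := fun δ y => by
    have := hexp.eq_of_comp_eq (g₁ := fun y => F (δ • y))
      (g₂ := fun y => F y + (F (δ • y₀) - F y₀)) (F.continuous.comp (hcont δ)) (by fun_prop)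
      (funext fun y => by
        simp only [Function.comp_apply, Circle.exp_add, Circle.exp_sub, hFf, hq.map_smul]
        simp) y₀ (by ring)
    exact congrFun this y
  refine ⟨γ, { toFun := fun δ => .ofAdd (F (δ • y₀) - F y₀), map_one' := by simp, map_mul' := ?_ },
    ?_, ?_, ?_⟩
  · intro δ ε
    rw [← ofAdd_add, mul_smul, hFδ δ (ε • y₀)]
    congr 1
    ring
  · intro δ
    -- γ was chosen at y₀ only. Both maps lift q, so they agree everywhere, and equivariance of the
    -- lifted rotation makes γ central.
    have hγ' : ∀ y, γ • y = Θ (1, y) := congrFun (hcov.eq_of_comp_eq (hcont γ) (by fun_prop)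
      (funext fun y => by simp only [Function.comp_apply, hq.map_smul, hΘ1]) y₀ hγ)
    refine hfree.right_cancel' _ _ y₀ ?_
    rw [mul_smul, mul_smul, hγ', hγ', hΘδ]
  · change Multiplicative.ofAdd (F (γ • y₀) - F y₀) = _
    have : γ • y₀ = Θ (1, y₀) := hγ
    rw [this, hFΘ, add_sub_cancel_left]
  · intro δ
    obtain ⟨m, hm⟩ := Circle.exp_eq_exp.1
      (show Circle.exp (F (δ • y₀)) = Circle.exp (F y₀) by rw [hFf, hFf, hq.map_smul])
    refine ⟨m, ?_⟩
    change Multiplicative.ofAdd (F (δ • y₀) - F y₀) = _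
    rw [hm, add_sub_cancel_left]

theorem isEmpty_torusB_homeomorph_prod_circle {n : ℕ} (hn : 1 ≤ n) (K : Type*)
    [TopologicalSpace K] : IsEmpty (TorusB n ≃ₜ K × Circle) := by
  refine ⟨fun h => ?_⟩
  obtain ⟨γ, ρ, hγ, hργ, hρ⟩ :=
    (isQuotientCoveringMap_torusBProj n).exists_central_of_homeomorph_prod_circle h
  obtain ⟨m, rfl⟩ := deckGroup.exists_eq_shift_zpow_of_commute hn hγ
  obtain ⟨j, hj⟩ := hρ (deckGroup.shift n)
  rw [map_zpow, hj, ← ofAdd_zsmul, Multiplicative.ofAdd.injective.eq_iff, zsmul_eq_mul] at hργ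
  -- The value 2π of ρ at γ is also 6m times its value 2πj at the shift.
  have h1 : ((6 * m * j : ℤ) : ℝ) = ((1 : ℤ) : ℝ) := by
    have := Real.pi_pos
    refine mul_right_cancel₀ (b := 2 * Real.pi) (by positivity) ?_
    push_cast at hργ ⊢
    linarith
  have h2 : 6 * (m * j) = 1 := by rw [← mul_assoc]; exact_mod_cast h1
  omega

/-! ### The first singular homology group of the base of a convex covering -/

open CategoryTheory AlgebraicTopology Simplicial

namespace SingularOne

section Chains

variable {X : Type} [TopologicalSpace X]

variable (X) in
/-- The singular chain complex with integral coefficients. -/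
abbrev complex : ChainComplex (ModuleCat.{0} ℤ) ℕ :=
  (TopCat.toSSet.obj (TopCat.of X)).chainComplex (ModuleCat.of ℤ ℤ)

/-- A continuous map on the standard simplex, as a singular simplex. -/
def simplex {n : ℕ} (f : C(stdSimplex ℝ (Fin (n + 1)), X)) :
    (TopCat.toSSet.obj (TopCat.of X)).obj (.op (SimplexCategory.mk n)) :=
  ((TopCat.of X).toSSetObjEquiv (.op (SimplexCategory.mk n))).symm f

/-- The map of standard simplices given by a map of vertices. -/
def vertexMap {m n : ℕ} (f : Fin m → Fin n) : C(stdSimplex ℝ (Fin m), stdSimplex ℝ (Fin n)) :=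
  ⟨stdSimplex.map f, stdSimplex.continuous_map f⟩

/-- The singular chain of a simplex. -/
def chain {n : ℕ} (f : C(stdSimplex ℝ (Fin (n + 1)), X)) : (complex X).X n :=
  ((TopCat.toSSet.obj (TopCat.of X)).ιChainComplex (R := ModuleCat.of ℤ ℤ) (simplex f)).hom (1 : ℤ)

theorem d_chain {n : ℕ} (f : C(stdSimplex ℝ (Fin (n + 2)), X)) :
    ((complex X).d (n + 1) n).hom (chain f) =
      ∑ i : Fin (n + 2), (-1 : ℤ) ^ (i : ℕ) • chain (f.comp (vertexMap i.succAbove)) := by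
  have h := (TopCat.toSSet.obj (TopCat.of X)).ιChainComplex_d (R := ModuleCat.of ℤ ℤ) (simplex f)
  have h2 := congrArg (fun g => g.hom (1 : ℤ)) h
  refine h2.trans ?_
  simp [ModuleCat.hom_sum]
  rfl

theorem hom_ext {n : ℕ} {A : Type} [AddCommGroup A] {φ ψ : (complex X).X n →ₗ[ℤ] A}
    (h : ∀ f, φ (chain f) = ψ (chain f)) : φ = ψ := by
  have : ModuleCat.ofHom φ = ModuleCat.ofHom ψ := by
    refine SSet.chainComplex_hom_ext fun x => ?_
    obtain ⟨f, rfl⟩ : ∃ f, x = simplex f := ⟨_, (Equiv.symm_apply_apply _ x).symm⟩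
    refine ModuleCat.hom_ext (LinearMap.ext_ring (h f))
  exact congrArg ModuleCat.Hom.hom this

/-- The linear map on chains with prescribed values on simplices. -/
def chainLift {n : ℕ} {A : Type} [AddCommGroup A]
    (φ : C(stdSimplex ℝ (Fin (n + 1)), X) → A) : (complex X).X n →ₗ[ℤ] A :=
  (Limits.Cofan.IsColimit.desc
    ((TopCat.toSSet.obj (TopCat.of X)).isColimitChainComplexXCofan (ModuleCat.of ℤ ℤ) n)
    (fun x => ModuleCat.ofHom (LinearMap.toSpanSingleton ℤ A
      (φ ((TopCat.of X).toSSetObjEquiv (.op (SimplexCategory.mk n)) x))))).hom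

theorem chainLift_chain {n : ℕ} {A : Type} [AddCommGroup A]
    (φ : C(stdSimplex ℝ (Fin (n + 1)), X) → A) (f : C(stdSimplex ℝ (Fin (n + 1)), X)) :
    chainLift φ (chain f) = φ f := by
  have h := Limits.Cofan.IsColimit.fac
    ((TopCat.toSSet.obj (TopCat.of X)).isColimitChainComplexXCofan (ModuleCat.of ℤ ℤ) n)
    (fun x => ModuleCat.ofHom (LinearMap.toSpanSingleton ℤ A
      (φ ((TopCat.of X).toSSetObjEquiv (.op (SimplexCategory.mk n)) x)))) (simplex f)
  have h2 := congrArg (fun g => g.hom (1 : ℤ)) h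
  refine h2.trans ?_
  simp [simplex]

end Chains

/-- A linear map out of the middle term that vanishes on boundaries, is surjective on cycles, and
detects boundaries among the cycles, identifies the homology. -/
def moduleCatHomologyEquiv {R : Type} [Ring R] (S : ShortComplex (ModuleCat.{0} R))
    {A : Type} [AddCommGroup A] [Module R A] (Φ : S.X₂ →ₗ[R] A)
    (h₀ : ∀ c, Φ (S.f.hom c) = 0)
    (hs : ∀ a, ∃ c, S.g.hom c = 0 ∧ Φ c = a)
    (hi : ∀ c, S.g.hom c = 0 → Φ c = 0 → c ∈ LinearMap.range S.f.hom) :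
    S.homology ≃ₗ[R] A := by
  let ψ := Φ.comp (LinearMap.ker S.g.hom).subtype
  have hψ : Function.Surjective ψ := fun a => by
    obtain ⟨c, hc, rfl⟩ := hs a
    exact ⟨⟨c, hc⟩, rfl⟩
  have hker : LinearMap.range S.moduleCatToCycles = LinearMap.ker ψ := by
    ext c
    constructor
    · rintro ⟨b, rfl⟩
      exact h₀ b
    · intro hc
      obtain ⟨b, hb⟩ := hi c.1 c.2 hc
      exact ⟨b, Subtype.ext hb⟩
  exact S.moduleCatHomologyIso.toLinearEquiv.trans
    ((Submodule.quotEquivOfEq _ _ hker).trans (ψ.quotKerEquivOfSurjective hψ))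

/-- A map on `1`-chains that vanishes on boundaries, is surjective on cycles, and detects
boundaries among the cycles, identifies the first homology. -/
def homologyEquiv {X : Type} [TopologicalSpace X] {A : Type} [AddCommGroup A]
    (Φ : (complex X).X 1 →ₗ[ℤ] A)
    (h₀ : ∀ c, Φ (((complex X).d 2 1).hom c) = 0)
    (hs : ∀ a, ∃ c, ((complex X).d 1 0).hom c = 0 ∧ Φ c = a)
    (hi : ∀ c, ((complex X).d 1 0).hom c = 0 → Φ c = 0 →
      c ∈ LinearMap.range ((complex X).d 2 1).hom) :
    H₁ X ≃ₗ[ℤ] A :=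
  (ShortComplex.homologyMapIso ((complex X).isoSc' 2 1 0 (by simp) (by simp))).toLinearEquiv.trans
    (moduleCatHomologyEquiv ((complex X).sc' 2 1 0) Φ h₀ hs hi)

end SingularOne

namespace SingularOne

open stdSimplex in
theorem vertexMap_vertex {m n : ℕ} (f : Fin m → Fin n) (i : Fin m) :
    vertexMap f (vertex i) = vertex (f i) := map_vertex f i

theorem vertexMap_id {m : ℕ} : vertexMap (id : Fin m → Fin m) = .id _ := by
  ext1 x
  exact stdSimplex.map_id_apply x

theorem vertexMap_comp {k m n : ℕ} (g : Fin m → Fin n) (f : Fin k → Fin m) :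
    (vertexMap g).comp (vertexMap f) = vertexMap (g ∘ f) := by
  ext1 x
  exact stdSimplex.map_comp_apply f g x

instance {m : ℕ} : SimplyConnectedSpace (stdSimplex ℝ (Fin (m + 1))) :=
  have := (convex_stdSimplex ℝ (Fin (m + 1))).contractibleSpace ⟨_, single_mem_stdSimplex ℝ 0⟩
  inferInstance

instance {m : ℕ} : LocallyPathConnectedSpace (stdSimplex ℝ (Fin m)) :=
  (convex_stdSimplex ℝ (Fin m)).locallyPathConnectedSpace

/-! ### Boundaries in low degree and 1-chains modulo boundaries. -/

section Boundary

variable {X : Type} [TopologicalSpace X]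

open stdSimplex (vertex)

/-- The `0`-chain of a point. -/
def point (x : X) : (complex X).X 0 := chain (.const _ x)

theorem chain_zero (f : C(stdSimplex ℝ (Fin 1), X)) : chain f = point (f (vertex 0)) := by
  refine congrArg chain (ContinuousMap.ext fun x => ?_)
  rw [ContinuousMap.const_apply, Subsingleton.elim x (vertex 0)]

theorem d_chain_one (f : C(stdSimplex ℝ (Fin 2), X)) :
    ((complex X).d 1 0).hom (chain f) = point (f (vertex 1)) - point (f (vertex 0)) := by
  rw [d_chain, Fin.sum_univ_two, chain_zero, chain_zero, ContinuousMap.comp_apply,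
    ContinuousMap.comp_apply, vertexMap_vertex, vertexMap_vertex, sub_eq_add_neg]
  simp

theorem d_chain_two (f : C(stdSimplex ℝ (Fin 3), X)) :
    ((complex X).d 2 1).hom (chain f) = chain (f.comp (vertexMap ![1, 2])) -
      chain (f.comp (vertexMap ![0, 2])) + chain (f.comp (vertexMap ![0, 1])) := by
  have h0 : (0 : Fin 3).succAbove = ![1, 2] := by decide
  have h1 : (1 : Fin 3).succAbove = ![0, 2] := by decide
  have h2 : (2 : Fin 3).succAbove = ![0, 1] := by decide
  rw [d_chain, Fin.sum_univ_three, h0, h1, h2, sub_eq_add_neg]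
  simp

theorem addHom_ext {n : ℕ} {A : Type} [AddCommGroup A] {φ ψ : (complex X).X n →+ A}
    (h : ∀ f, φ (chain f) = ψ (chain f)) : φ = ψ := by
  let φ' : (complex X).X n →ₗ[ℤ] A := { φ with map_smul' := fun c x => map_intCast_smul φ ℤ ℤ c x }
  let ψ' : (complex X).X n →ₗ[ℤ] A := { ψ with map_smul' := fun c x => map_intCast_smul ψ ℤ ℤ c x }
  have h' : φ' = ψ' := hom_ext h
  exact AddMonoidHom.ext fun x => LinearMap.congr_fun h' x

variable (X) in
/-- The group of `1`-chains modulo boundaries. -/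
abbrev ChainClass : Type :=
  (complex X).X 1 ⧸ (AddMonoidHom.range ((complex X).d 2 1).hom.toAddMonoidHom)

/-- The class of a singular `1`-simplex modulo boundaries. -/
def chainClass (f : C(stdSimplex ℝ (Fin 2), X)) : ChainClass X := QuotientAddGroup.mk (chain f)

theorem chainClass_triangle (f : C(stdSimplex ℝ (Fin 3), X)) :
    chainClass (f.comp (vertexMap ![0, 2])) =
      chainClass (f.comp (vertexMap ![0, 1])) + chainClass (f.comp (vertexMap ![1, 2])) := by
  have h : (QuotientAddGroup.mk (((complex X).d 2 1).hom (chain f)) : ChainClass X) = 0 :=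
    (QuotientAddGroup.eq_zero_iff _).2 ⟨chain f, rfl⟩
  rw [d_chain_two, QuotientAddGroup.mk_add, QuotientAddGroup.mk_sub] at h
  rw [← sub_eq_zero, ← neg_eq_zero, ← h]
  simp only [chainClass]
  abel

end Boundary

/-! ### Paths and segments in a vector space, projected to the base. -/

section Convex

variable {X Y : Type} [TopologicalSpace X] [NormedAddCommGroup Y] [NormedSpace ℝ Y]

open stdSimplex (vertex)

/-- The affine simplex with given vertices. -/
def affine {m : ℕ} (p : Fin m → Y) : C(stdSimplex ℝ (Fin m), Y) where
  toFun x := ∑ i, x i • p i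
  continuous_toFun := continuous_finsetSum _ fun i _ =>
    ((continuous_apply i).comp continuous_subtype_val).smul continuous_const

theorem affine_comp_vertexMap {k m : ℕ} (p : Fin m → Y) (f : Fin k → Fin m) :
    (affine p).comp (vertexMap f) = affine (p ∘ f) := by
  ext1 x
  change ∑ i, stdSimplex.map f x i • p i = ∑ j, x j • p (f j)
  simp only [stdSimplex.map_coe, FunOnFinite.linearMap_apply_apply, Finset.sum_smul]
  rw [← Finset.sum_fiberwise Finset.univ f]
  refine Finset.sum_congr rfl fun i _ => Finset.sum_congr rfl fun j hj => ?_
  rw [(Finset.mem_filter.1 hj).2]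

theorem affine_vertex {m : ℕ} (p : Fin m → Y) (i : Fin m) : affine p (vertex i) = p i := by
  change ∑ j, (Pi.single i (1 : ℝ) : Fin m → ℝ) j • p j = p i
  rw [Finset.sum_eq_single i] <;> simp +contextual

theorem affine_const {m : ℕ} (a : Y) : affine (fun _ : Fin m => a) = .const _ a := by
  ext1 x
  change ∑ j, x j • a = a
  rw [← Finset.sum_smul, stdSimplex.sum_eq_one, one_smul]

variable (q : C(Y, X))

/-- The class of the image of a segment. -/
def segmentClass (a b : Y) : ChainClass X := chainClass (q.comp (affine ![a, b]))

theorem segmentClass_add (a b c : Y) :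
    segmentClass q a b + segmentClass q b c = segmentClass q a c := by
  have h := chainClass_triangle (q.comp (affine ![a, b, c]))
  simp only [ContinuousMap.comp_assoc, affine_comp_vertexMap] at h
  have h1 : ![a, b, c] ∘ ![0, 2] = ![a, c] := by ext i; fin_cases i <;> rfl
  have h2 : ![a, b, c] ∘ ![0, 1] = ![a, b] := by ext i; fin_cases i <;> rfl
  have h3 : ![a, b, c] ∘ ![1, 2] = ![b, c] := by ext i; fin_cases i <;> rfl
  rw [h1, h2, h3] at h
  exact h.symm

theorem segmentClass_self (a : Y) : segmentClass q a a = 0 := by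
  simpa using segmentClass_add q a a a

theorem segmentClass_symm (a b : Y) : segmentClass q a b = -segmentClass q b a := by
  rw [eq_neg_iff_add_eq_zero, segmentClass_add, segmentClass_self]

theorem chainClass_const (a : Y) : chainClass (q.comp (.const _ a)) = 0 := by
  rw [← segmentClass_self q a, segmentClass, ← affine_const]
  congr 3
  ext i; fin_cases i <;> rfl

/-- The homotopy between a path and the segment with the same end points. -/
def straighten (F : C(stdSimplex ℝ (Fin 2), Y)) {m : ℕ} (f g : Fin m → Fin 2) :
    C(stdSimplex ℝ (Fin m), Y) where
  toFun x := (1 - vertexMap g x 1) • F (vertexMap f x) +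
    vertexMap g x 1 • affine ![F (vertex 0), F (vertex 1)] (vertexMap f x)
  continuous_toFun := by
    have h : Continuous fun x => vertexMap g x 1 :=
      (continuous_apply (1 : Fin 2)).comp (continuous_subtype_val.comp (vertexMap g).continuous)
    fun_prop

theorem straighten_comp (F : C(stdSimplex ℝ (Fin 2), Y)) {k m : ℕ} (f g : Fin m → Fin 2)
    (h : Fin k → Fin m) :
    (straighten F f g).comp (vertexMap h) = straighten F (f ∘ h) (g ∘ h) := by
  ext1 x
  simp only [straighten, ContinuousMap.comp_apply, ContinuousMap.coe_mk, ← vertexMap_comp]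

theorem vertexMap_const {m : ℕ} (i : Fin 2) (x : stdSimplex ℝ (Fin m)) :
    vertexMap (fun _ => i) x = vertex i := by
  refine stdSimplex.ext ?_
  ext j
  change stdSimplex.map _ x j = _
  simp only [stdSimplex.map_coe, FunOnFinite.linearMap_apply_apply]
  by_cases h : i = j
  · subst h
    simp
  · simp [h, Ne.symm h]

theorem straighten_zero (F : C(stdSimplex ℝ (Fin 2), Y)) :
    straighten F id (fun _ => 0) = F := by
  ext1 x
  simp [straighten, vertexMap_const, vertexMap_id]

theorem straighten_one (F : C(stdSimplex ℝ (Fin 2), Y)) :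
    straighten F id (fun _ => 1) = affine ![F (vertex 0), F (vertex 1)] := by
  ext1 x
  simp [straighten, vertexMap_const, vertexMap_id]

theorem straighten_const (F : C(stdSimplex ℝ (Fin 2), Y)) (i : Fin 2) {m : ℕ} (g : Fin m → Fin 2) :
    straighten F (fun _ => i) g = .const _ (F (vertex i)) := by
  ext1 x
  have h : ![F (vertex 0), F (vertex 1)] i = F (vertex i) := by fin_cases i <;> rfl
  simp only [straighten, vertexMap_const, ContinuousMap.coe_mk, affine_vertex, h, ← add_smul,
    sub_add_cancel, one_smul, ContinuousMap.const_apply]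

/-- The straight-line homotopy is a square cut along its diagonal into two triangles. Its vertical
sides are constant paths and contribute zero, so its top and bottom have the same class as the
diagonal. -/
theorem chainClass_comp (F : C(stdSimplex ℝ (Fin 2), Y)) :
    chainClass (q.comp F) = segmentClass q (F (vertex 0)) (F (vertex 1)) := by
  have e0 : (![0, 1] : Fin 2 → Fin 2) = id := by decide
  have e1 : (![0, 0] : Fin 2 → Fin 2) = fun _ => 0 := by decide
  have e2 : (![1, 1] : Fin 2 → Fin 2) = fun _ => 1 := by decide
  -- The two lists are the path and homotopy coordinates of the vertices: this triangle is (0,0),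
  -- (1,0), (1,1), the next one (0,0), (0,1), (1,1).
  have h1 := chainClass_triangle (q.comp (straighten F ![0, 1, 1] ![0, 0, 1]))
  have h2 := chainClass_triangle (q.comp (straighten F ![0, 0, 1] ![0, 1, 1]))
  simp only [ContinuousMap.comp_assoc, straighten_comp] at h1 h2
  rw [show (![0, 1, 1] : Fin 3 → Fin 2) ∘ ![0, 2] = id by decide,
    show (![0, 0, 1] : Fin 3 → Fin 2) ∘ ![0, 2] = id by decide,
    show (![0, 1, 1] : Fin 3 → Fin 2) ∘ ![0, 1] = id by decide,
    show (![0, 0, 1] : Fin 3 → Fin 2) ∘ ![0, 1] = fun _ => 0 by decide,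
    show (![0, 1, 1] : Fin 3 → Fin 2) ∘ ![1, 2] = fun _ => 1 by decide,
    straighten_zero, straighten_const, chainClass_const, add_zero] at h1
  rw [show (![0, 1, 1] : Fin 3 → Fin 2) ∘ ![0, 2] = id by decide,
    show (![0, 0, 1] : Fin 3 → Fin 2) ∘ ![0, 2] = id by decide,
    show (![0, 0, 1] : Fin 3 → Fin 2) ∘ ![0, 1] = fun _ => 0 by decide,
    show (![0, 1, 1] : Fin 3 → Fin 2) ∘ ![1, 2] = fun _ => 1 by decide,
    show (![0, 0, 1] : Fin 3 → Fin 2) ∘ ![1, 2] = id by decide,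
    straighten_one, straighten_const, chainClass_const, zero_add] at h2
  rw [← h1, h2, segmentClass]

end Convex

/-! ### The homomorphism from 1-chains to the abelianized deck group. -/

section Covering

variable {X Y G : Type} [TopologicalSpace X] [TopologicalSpace Y] [Group G]
  [MulAction G Y] {q : C(Y, X)}

open stdSimplex (vertex)

/-- `Function.surjInv` is a set-theoretic section of q, and freeness of the action gives g 0 = 1.
Besides paths, this serves triangles, whose edges then have transitions (g i)⁻¹ g j. -/
theorem exists_transition (hq : IsQuotientCoveringMap q G) {m : ℕ}
    (σ : C(stdSimplex ℝ (Fin (m + 1)), X)) :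
    ∃ (F : C(stdSimplex ℝ (Fin (m + 1)), Y)) (g : Fin (m + 1) → G), q.comp F = σ ∧ g 0 = 1 ∧
      ∀ i, F (vertex i) = g i • Function.surjInv hq.surjective (σ (vertex i)) := by
  obtain ⟨F, ⟨h1, h2⟩, -⟩ := hq.isCoveringMap.existsUnique_continuousMap_lifts σ (vertex 0) _
    (Function.surjInv_eq hq.surjective _)
  have h : ∀ i, ∃ g : G, g • Function.surjInv hq.surjective (σ (vertex i)) = F (vertex i) :=
    fun i => hq.apply_eq_iff_mem_orbit.1
      ((congrFun h2 (vertex i)).trans (Function.surjInv_eq hq.surjective _).symm)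
  choose g hg using h
  refine ⟨F, g, ContinuousMap.ext fun x => congrFun h2 x, ?_, fun i => (hg i).symm⟩
  have := hq.isCancelSMul
  refine IsCancelSMul.right_cancel _ _ (Function.surjInv hq.surjective (σ (vertex 0))) ?_
  rw [hg, h1, one_smul]

/-- The deck transformation comparing the end point of the lift of a path with the chosen
point of the fibre. -/
def transition (hq : IsQuotientCoveringMap q G) (σ : C(stdSimplex ℝ (Fin 2), X)) : G :=
  (exists_transition hq σ).choose_spec.choose 1

theorem exists_lift_transition (hq : IsQuotientCoveringMap q G) (σ : C(stdSimplex ℝ (Fin 2), X)) :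
    ∃ F : C(stdSimplex ℝ (Fin 2), Y), q.comp F = σ ∧
      F (vertex 0) = Function.surjInv hq.surjective (σ (vertex 0)) ∧
      F (vertex 1) = transition hq σ • Function.surjInv hq.surjective (σ (vertex 1)) := by
  obtain ⟨h1, h2, h3⟩ := (exists_transition hq σ).choose_spec.choose_spec
  refine ⟨_, h1, ?_, h3 1⟩
  rw [h3 0, h2, one_smul]

/-- The transition can be computed from any lift: F is the g-translate of the normalized one, by
uniqueness of lifts. -/
theorem transition_comp (hq : IsQuotientCoveringMap q G) (F : C(stdSimplex ℝ (Fin 2), Y)) (g h : G)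
    (h0 : F (vertex 0) = g • Function.surjInv hq.surjective (q (F (vertex 0))))
    (h1 : F (vertex 1) = h • Function.surjInv hq.surjective (q (F (vertex 1)))) :
    transition hq (q.comp F) = g⁻¹ * h := by
  have := hq.toContinuousConstSMul
  have := hq.isCancelSMul
  obtain ⟨F', e, e0, e1⟩ := exists_lift_transition hq (q.comp F)
  have hF : (fun x => g • F' x) = F := by
    refine hq.isCoveringMap.eq_of_comp_eq (by fun_prop) F.continuous ?_ (vertex 0) ?_
    · exact funext fun x => (hq.map_smul g).trans (DFunLike.congr_fun e x)
    · rw [e0, h0]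
      rfl
  have h2 := congrFun hF (vertex 1)
  rw [e1, h1, smul_smul] at h2
  rw [eq_inv_mul_iff_mul_eq]
  exact IsCancelSMul.right_cancel _ _ _ h2

/-- The homomorphism from `1`-chains to the abelianized deck group. -/
def transitionHom (hq : IsQuotientCoveringMap q G) :
    (complex X).X 1 →ₗ[ℤ] Additive (Abelianization G) :=
  chainLift fun σ => .ofMul (.of (transition hq σ))

theorem transitionHom_d (hq : IsQuotientCoveringMap q G) (c : (complex X).X 2) :
    transitionHom hq (((complex X).d 2 1).hom c) = 0 := by
  suffices h : (transitionHom hq).comp ((complex X).d 2 1).hom = 0 from LinearMap.congr_fun h c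
  refine hom_ext fun τ => ?_
  obtain ⟨F, g, rfl, -, hg⟩ := exists_transition hq τ
  have key : ∀ i j : Fin 3, transition hq ((q.comp F).comp (vertexMap ![i, j])) =
      (g i)⁻¹ * g j := fun i j => by
    rw [ContinuousMap.comp_assoc]
    refine transition_comp hq _ _ _ ?_ ?_ <;>
    · rw [ContinuousMap.comp_apply, vertexMap_vertex]
      exact hg _
  rw [LinearMap.comp_apply, d_chain_two, map_add, map_sub]
  simp only [transitionHom, chainLift_chain, key]
  simp only [map_mul, map_inv, ofMul_mul, ofMul_inv, LinearMap.zero_apply]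
  abel

end Covering

/-! ### First homology as the abelianized deck group. -/

section Homology

variable {X Y G : Type} [TopologicalSpace X] [NormedAddCommGroup Y] [NormedSpace ℝ Y] [Group G]
  [MulAction G Y] {q : C(Y, X)}

open stdSimplex (vertex)

/-- The action need not be affine, so the translate of a segment is only a path. It has the same
projection, and straightening it does not change the class. -/
theorem segmentClass_smul (hq : IsQuotientCoveringMap q G) (g : G) (a b : Y) :
    segmentClass q (g • a) (g • b) = segmentClass q a b := by
  have := hq.toContinuousConstSMul
  let F : C(stdSimplex ℝ (Fin 2), Y) := ⟨fun x => g • affine ![a, b] x, by fun_prop⟩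
  have h : q.comp F = q.comp (affine ![a, b]) := ContinuousMap.ext fun x => hq.map_smul g
  have h2 := chainClass_comp q F
  rw [h, chainClass_comp] at h2
  simpa [F, affine_vertex] using h2.symm

/-- The class of the projected segment from a base point to its translate. -/
def deckClass (hq : IsQuotientCoveringMap q G) (y : Y) :
    Additive (Abelianization G) →+ ChainClass X :=
  MonoidHom.toAdditiveLeft (Abelianization.lift
    { toFun := fun g => .ofAdd (segmentClass q y (g • y))
      map_one' := by rw [one_smul, segmentClass_self]; rfl
      map_mul' := fun g h => by
        rw [← segmentClass_add q y (g • y), mul_smul, segmentClass_smul hq]; rfl })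

/-- A lift from a to g • b is routed through y and g • y; the segment from g • y to g • b counts as
that from y to b. What remains besides the deck class depends only on the boundary, so a cycle
killed by `transitionHom` is itself a boundary. -/
theorem mk_eq_deckClass_add (hq : IsQuotientCoveringMap q G) (y : Y) (c : (complex X).X 1) :
    (QuotientAddGroup.mk c : ChainClass X) = deckClass hq y (transitionHom hq c) +
      chainLift (fun f => segmentClass q y (Function.surjInv hq.surjective (f (vertex 0))))
        (((complex X).d 1 0).hom c) := by
  suffices h : QuotientAddGroup.mk' _ = (deckClass hq y).comp (transitionHom hq).toAddMonoidHom +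
      (chainLift (fun f => segmentClass q y
        (Function.surjInv hq.surjective (f (vertex 0))))).toAddMonoidHom.comp
        ((complex X).d 1 0).hom.toAddMonoidHom from DFunLike.congr_fun h c
  refine addHom_ext fun σ => ?_
  obtain ⟨F, e, e0, e1⟩ := exists_lift_transition hq σ
  change chainClass σ = deckClass hq y (transitionHom hq (chain σ)) +
      chainLift (fun f => segmentClass q y (Function.surjInv hq.surjective (f (vertex 0))))
        (((complex X).d 1 0).hom (chain σ))
  rw [transitionHom, chainLift_chain, d_chain_one, map_sub, point, point, chainLift_chain,
    chainLift_chain]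
  conv_lhs => rw [← e]
  rw [chainClass_comp, e0, e1]
  generalize transition hq σ = g
  simp only [ContinuousMap.const_apply]
  generalize Function.surjInv hq.surjective (σ (vertex 0)) = a
  generalize Function.surjInv hq.surjective (σ (vertex 1)) = b
  change segmentClass q a (g • b) = segmentClass q y (g • y) + (segmentClass q y b - segmentClass q y a)
  rw [← segmentClass_smul hq g y b, ← segmentClass_add q a y (g • b),
    ← segmentClass_add q y (g • y) (g • b), segmentClass_symm q a y]
  abel

/-- The first homology of the base of a covering by a contractible space is the abelianization of
the group of deck transformations. -/
def firstHomologyEquiv (hq : IsQuotientCoveringMap q G) :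
    H₁ X ≃ₗ[ℤ] Additive (Abelianization G) := by
  refine homologyEquiv (transitionHom hq) (transitionHom_d hq) (fun a => ?_) fun c hc hc' => ?_
  · obtain ⟨g, hg⟩ := QuotientGroup.mk'_surjective _ a.toMul
    let y := Function.surjInv hq.surjective (q 0)
    have hy : q y = q 0 := Function.surjInv_eq hq.surjective _
    -- The projected segment is a loop. Starting at the chosen point y of the fibre makes its
    -- transition exactly g.
    refine ⟨chain (q.comp (affine ![y, g • y])), ?_, ?_⟩
    · rw [d_chain_one]
      simp [affine_vertex, hq.map_smul]
    · rw [transitionHom, chainLift_chain, transition_comp hq _ 1 g]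
      · rw [inv_one, one_mul]
        exact congrArg Additive.ofMul hg
      · simp [affine_vertex, hy, y]
      · simp [affine_vertex, hq.map_smul, hy, y]
  · have h := mk_eq_deckClass_add hq 0 c
    rw [hc, hc', map_zero, map_zero, add_zero, QuotientAddGroup.eq_zero_iff] at h
    exact h

end Homology

end SingularOne

theorem nonempty_H₁_torusB_equiv (n : ℕ) : Nonempty (H₁ (TorusB n) ≃ₗ[ℤ] ℤ) := by
  have hq : IsQuotientCoveringMap (⟨torusBProj n, (isOpenQuotientMap_torusBProj n).continuous⟩ :
    C(EuclideanSpace ℂ (Fin n) × ℝ, TorusB n)) (deckGroup n) := isQuotientCoveringMap_torusBProj n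
  exact ⟨(SingularOne.firstHomologyEquiv hq).trans
    (deckGroup.abelianizationEquiv n).symm.toIntLinearEquiv⟩

theorem firstBetti_torusB (n : ℕ) : firstBetti (TorusB n) = 1 := by
  obtain ⟨e⟩ := nonempty_H₁_torusB_equiv n
  rw [firstBetti, e.rank_eq, Module.rank_self]

/-! ### Manifolds covered by a vector space with affine deck transformations -/

/-- A surjective local homeomorphism `q : F → X` from a vector space, whose local inverses form
the atlas of `X`, and whose deck transformations are affine with linear part in `𝓛`. -/
structure IsAffineCover {F X : Type*} [NormedAddCommGroup F] [NormedSpace ℝ F] [TopologicalSpace X]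
    [ChartedSpace F X] (q : F → X) (𝓛 : Set (F ≃L[ℝ] F)) : Prop where
  surjective : Function.Surjective q
  isLocalHomeomorph : IsLocalHomeomorph q
  eqOn_symm : ∀ e ∈ atlas F X, Set.EqOn e.symm q e.target
  exists_deck : ∀ y y', q y = q y' → ∃ L ∈ 𝓛, ∀ w, q (y' + L (w - y)) = q w

namespace IsAffineCover

variable {F X : Type*} [NormedAddCommGroup F] [NormedSpace ℝ F] [TopologicalSpace X]
  [ChartedSpace F X] {q : F → X} {𝓛 : Set (F ≃L[ℝ] F)}

/-- The point y need not lie in the target of e. An affine deck map carries it to e (q y), near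
which e inverts q. -/
theorem eventually_comp_eq (hq : IsAffineCover q 𝓛) {e : OpenPartialHomeomorph X F}
    (he : Set.EqOn e.symm q e.target) {y : F} (hy : q y ∈ e.source) :
    ∃ L ∈ 𝓛, ∀ᶠ w in 𝓝 y, e (q w) = e (q y) + L (w - y) := by
  obtain ⟨L, hL, h⟩ := hq.exists_deck y (e (q y))
    (by rw [← he (e.map_source hy), e.left_inv hy])
  refine ⟨L, hL, ?_⟩
  have hc : Filter.Tendsto (fun w => e (q y) + L (w - y)) (𝓝 y) (𝓝 (e (q y))) := by
    have : ContinuousAt (fun w => e (q y) + L (w - y)) y := by fun_prop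
    simpa [ContinuousAt] using this
  filter_upwards [hc.eventually (e.open_target.mem_nhds (e.map_source hy))] with w hw
  rw [← h w, ← he hw, e.right_inv hw]

theorem hasFDerivAt_comp (hq : IsAffineCover q 𝓛) {e : OpenPartialHomeomorph X F}
    (he : Set.EqOn e.symm q e.target) {y : F} (hy : q y ∈ e.source) :
    ∃ L ∈ 𝓛, HasFDerivAt (e ∘ q) (L : F →L[ℝ] F) y := by
  obtain ⟨L, hL, h⟩ := hq.eventually_comp_eq he hy
  refine ⟨L, hL, HasFDerivAt.congr_of_eventuallyEq ?_ h⟩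
  exact (L.hasFDerivAt.comp y ((hasFDerivAt_id y).sub_const y)).const_add _

theorem contDiffAt_comp (hq : IsAffineCover q 𝓛) {e : OpenPartialHomeomorph X F}
    (he : Set.EqOn e.symm q e.target) {y : F} (hy : q y ∈ e.source) :
    ContDiffAt ℝ ∞ (e ∘ q) y := by
  obtain ⟨L, hL, h⟩ := hq.eventually_comp_eq he hy
  refine ContDiffAt.congr_of_eventuallyEq ?_ h
  fun_prop

theorem symm_trans_mem (hq : IsAffineCover q 𝓛) {e e' : OpenPartialHomeomorph X F}
    (he : Set.EqOn e.symm q e.target) (he' : Set.EqOn e'.symm q e'.target) :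
    e.symm ≫ₕ e' ∈ contDiffGroupoid ∞ 𝓘(ℝ, F) := by
  have key : ∀ {e e' : OpenPartialHomeomorph X F}, Set.EqOn e.symm q e.target →
      Set.EqOn e'.symm q e'.target → ContDiffOn ℝ ∞ (e.symm ≫ₕ e') (e.symm ≫ₕ e').source := by
    intro e e' he he' y hy
    have hy1 : y ∈ e.target := by simpa using hy.1
    have hy2 : e.symm y ∈ e'.source := by simpa using hy.2
    rw [he hy1] at hy2
    refine ((hq.contDiffAt_comp he' hy2).congr_of_eventuallyEq ?_).contDiffWithinAt
    filter_upwards [e.open_target.mem_nhds hy1] with w hw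
    simp [he hw]
  rw [contDiffGroupoid, mem_groupoid_of_pregroupoid]
  refine ⟨?_, ?_⟩
  · simpa [contDiffPregroupoid] using key he he'
  · simpa [contDiffPregroupoid] using key he' he

theorem isManifold (hq : IsAffineCover q 𝓛) : IsManifold 𝓘(ℝ, F) ∞ X where
  compatible he he' := hq.symm_trans_mem (hq.eqOn_symm _ he) (hq.eqOn_symm _ he')

theorem mem_maximalAtlas (hq : IsAffineCover q 𝓛) {e : OpenPartialHomeomorph X F}
    (he : Set.EqOn e.symm q e.target) : e ∈ IsManifold.maximalAtlas 𝓘(ℝ, F) ∞ X :=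
  fun _ he' => ⟨hq.symm_trans_mem he (hq.eqOn_symm _ he'), hq.symm_trans_mem (hq.eqOn_symm _ he') he⟩

theorem isLocalDiffeomorph (hq : IsAffineCover q 𝓛) :
    IsLocalDiffeomorph 𝓘(ℝ, F) 𝓘(ℝ, F) ∞ q := by
  intro y
  obtain ⟨p, hy, rfl⟩ := hq.isLocalHomeomorph y
  have hp := hq.mem_maximalAtlas (e := p.symm) fun _ _ => rfl
  exact ⟨⟨p.toPartialEquiv, p.open_source, p.open_target,
    contMDiffOn_symm_of_mem_maximalAtlas hp, contMDiffOn_of_mem_maximalAtlas hp⟩, hy, fun _ _ => rfl⟩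

theorem mfderiv_mem (hq : IsAffineCover q 𝓛) (y : F) :
    ∃ L ∈ 𝓛, ∀ u : F, mfderiv 𝓘(ℝ, F) 𝓘(ℝ, F) q y u = L u := by
  obtain ⟨L, hL, h⟩ := hq.hasFDerivAt_comp (hq.eqOn_symm _ (chart_mem_atlas F (q y)))
    (mem_chart_source F (q y))
  refine ⟨L, hL, fun u => ?_⟩
  have hd := hq.isLocalDiffeomorph.mdifferentiable (by simp) y
  have hf : fderivWithin ℝ (writtenInExtChartAt 𝓘(ℝ, F) 𝓘(ℝ, F) y q) (Set.range 𝓘(ℝ, F))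
      (extChartAt 𝓘(ℝ, F) y y) = L := by
    simp only [writtenInExtChartAt, mfld_simps, fderivWithin_univ]
    exact h.fderiv
  rw [hd.mfderiv]
  exact DFunLike.congr_fun hf u

variable [IsManifold 𝓘(ℝ, F) ∞ X]

/-- This reduces the structure group of the tangent bundle to 𝓛. -/
theorem coordChange_mem (hq : IsAffineCover q 𝓛) (x₀ x z : X) (hx : z ∈ (chartAt F x).source) (hx' : z ∈ (chartAt F x₀).source) :
    ∃ L ∈ 𝓛, (tangentBundleCore 𝓘(ℝ, F) X).coordChange (achart F x) (achart F x₀) z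
      = (L : F →L[ℝ] F) := by
  have he := hq.eqOn_symm _ (chart_mem_atlas F x)
  have hz : q (chartAt F x z) = z := by
    rw [← he ((chartAt F x).map_source hx), (chartAt F x).left_inv hx]
  obtain ⟨L, hL, h⟩ := hq.hasFDerivAt_comp (hq.eqOn_symm _ (chart_mem_atlas F x₀))
    (y := chartAt F x z) (by rwa [hz])
  refine ⟨L, hL, ?_⟩
  rw [tangentBundleCore_coordChange_achart]
  simp only [mfld_simps, fderivWithin_univ]
  refine HasFDerivAt.fderiv (h.congr_of_eventuallyEq ?_)
  filter_upwards [(chartAt F x).open_target.mem_nhds ((chartAt F x).map_source hx)] with w hw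
  simp [he hw]

end IsAffineCover

/-! ### Smoothness of invariant constant tensors. -/

namespace IsAffineCover

variable {F X : Type*} [NormedAddCommGroup F] [NormedSpace ℝ F] [TopologicalSpace X]
  [ChartedSpace F X] {q : F → X} {𝓛 : Set (F ≃L[ℝ] F)} [IsManifold 𝓘(ℝ, F) ∞ X]

theorem continuousLinearMapAt_mem (hq : IsAffineCover q 𝓛) {x₀ x : X}
    (hx : x ∈ (chartAt F x₀).source) :
    ∃ L ∈ 𝓛, ∀ u : F,
      (trivializationAt F (TangentSpace 𝓘(ℝ, F)) x₀).continuousLinearMapAt ℝ x u = L u := by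
  obtain ⟨L, hL, h⟩ := hq.coordChange_mem x₀ x x (mem_chart_source F x) hx
  refine ⟨L, hL, fun u => ?_⟩
  rw [TangentBundle.continuousLinearMapAt_trivializationAt_eq_core hx]
  exact DFunLike.congr_fun h u

theorem symmL_mem (hq : IsAffineCover q 𝓛) {x₀ x : X} (hx : x ∈ (chartAt F x₀).source) :
    ∃ L ∈ 𝓛, ∀ u : F,
      (trivializationAt F (TangentSpace 𝓘(ℝ, F)) x₀).symmL ℝ x u = L u := by
  obtain ⟨L, hL, h⟩ := hq.coordChange_mem x x₀ x hx (mem_chart_source F x)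
  refine ⟨L, hL, fun u => ?_⟩
  rw [TangentBundle.symmL_trivializationAt_eq_core hx]
  exact DFunLike.congr_fun h u

/-- Each tangent space is F via the preferred chart at its point. A trivialization changes a vector
by some L in 𝓛 depending on the point, which fixes ξ, so the field is locally constant in it. The
other tensors below are treated alike. -/
theorem isSmoothVectorField_const (hq : IsAffineCover q 𝓛) (ξ : F) (hξ : ∀ L ∈ 𝓛, L ξ = ξ) :
    IsSmoothVectorField (M := X) 𝓘(ℝ, F) (fun _ => ξ) := by
  intro x₀
  refine (Bundle.contMDiffAt_section (E := TangentSpace 𝓘(ℝ, F)) x₀).2 ?_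
  refine (contMDiffAt_const (c := ξ)).congr_of_eventuallyEq ?_
  filter_upwards [(chartAt F x₀).open_source.mem_nhds (mem_chart_source F x₀)] with x hx
  obtain ⟨L, hL, h⟩ := hq.continuousLinearMapAt_mem hx
  exact (Bundle.Trivialization.continuousLinearMapAt_apply_of_mem ℝ
    (trivializationAt F (TangentSpace 𝓘(ℝ, F)) x₀) (by simpa using hx) _).symm.trans
    ((h ξ).trans (hξ L hL))

theorem isSmoothEndomorphismField_const (hq : IsAffineCover q 𝓛) (J : F →L[ℝ] F)
    (hJ : ∀ L ∈ 𝓛, ∀ u, J (L u) = L (J u)) :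
    IsSmoothEndomorphismField (M := X) 𝓘(ℝ, F) (fun _ => J) := by
  intro x₀
  rw [contMDiffAt_hom_bundle]
  refine ⟨contMDiffAt_id, (contMDiffAt_const (c := J)).congr_of_eventuallyEq ?_⟩
  filter_upwards [(chartAt F x₀).open_source.mem_nhds (mem_chart_source F x₀)] with x hx
  obtain ⟨L, hL, h⟩ := hq.symmL_mem hx
  ext u
  have h1 := (trivializationAt F (TangentSpace 𝓘(ℝ, F)) x₀).continuousLinearMapAt_symmL (R := ℝ)
    (b := x) (by simpa using hx) (J u)
  change (trivializationAt F (TangentSpace 𝓘(ℝ, F)) x₀).continuousLinearMapAt ℝ x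
    (J ((trivializationAt F (TangentSpace 𝓘(ℝ, F)) x₀).symmL ℝ x u)) = J u
  rw [h u, hJ L hL u, ← h (J u)]
  exact h1

theorem isSmoothOneForm_const (hq : IsAffineCover q 𝓛) (η : F →L[ℝ] ℝ)
    (hη : ∀ L ∈ 𝓛, ∀ u, η (L u) = η u) :
    IsSmoothOneForm (M := X) 𝓘(ℝ, F) (fun _ => η) := by
  intro x₀
  rw [contMDiffAt_hom_bundle]
  refine ⟨contMDiffAt_id, (contMDiffAt_const (c := η)).congr_of_eventuallyEq ?_⟩
  filter_upwards [(chartAt F x₀).open_source.mem_nhds (mem_chart_source F x₀)] with x hx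
  obtain ⟨L, hL, h⟩ := hq.symmL_mem hx
  ext u
  simp only [ContinuousLinearMap.inCoordinates, Bundle.Trivial.continuousLinearMapAt_trivialization,
    Bundle.Trivial.fiberBundle_trivializationAt']
  change η ((trivializationAt F (TangentSpace 𝓘(ℝ, F)) x₀).symmL ℝ x u) = η u
  rw [h u, hη L hL u]

theorem hom_trivializationAt_linearMapAt {x₀ x : X} (hx : x ∈ (chartAt F x₀).source)
    (φ : TangentSpace 𝓘(ℝ, F) x →L[ℝ] ℝ) (v : F) :
    (trivializationAt (F →L[ℝ] ℝ) (fun x : X => TangentSpace 𝓘(ℝ, F) x →L[ℝ] ℝ) x₀).linearMapAt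
      ℝ x φ v = φ ((trivializationAt F (TangentSpace 𝓘(ℝ, F)) x₀).symmL ℝ x v) := by
  rw [Bundle.Trivialization.coe_linearMapAt_of_mem _ (by simpa using hx)]
  simp [hom_trivializationAt_apply, ContinuousLinearMap.inCoordinates]

theorem contMDiff_bilinear_const (hq : IsAffineCover q 𝓛) (g : F →L[ℝ] F →L[ℝ] ℝ)
    (hg : ∀ L ∈ 𝓛, ∀ u v, g (L u) (L v) = g u v) :
    ContMDiff 𝓘(ℝ, F) (𝓘(ℝ, F).prod 𝓘(ℝ, F →L[ℝ] F →L[ℝ] ℝ)) ∞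
      (fun x : X => Bundle.TotalSpace.mk' (F →L[ℝ] F →L[ℝ] ℝ)
        (E := fun x : X => TangentSpace 𝓘(ℝ, F) x →L[ℝ] TangentSpace 𝓘(ℝ, F) x →L[ℝ] ℝ) x g) := by
  intro x₀
  refine (Bundle.contMDiffAt_section
    (E := fun x : X => TangentSpace 𝓘(ℝ, F) x →L[ℝ] TangentSpace 𝓘(ℝ, F) x →L[ℝ] ℝ) x₀).2 ?_
  refine (contMDiffAt_const (c := g)).congr_of_eventuallyEq ?_
  filter_upwards [(chartAt F x₀).open_source.mem_nhds (mem_chart_source F x₀)] with x hx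
  obtain ⟨L, hL, h⟩ := hq.symmL_mem hx
  ext u v
  simp only [hom_trivializationAt_apply, ContinuousLinearMap.inCoordinates]
  refine (hom_trivializationAt_linearMapAt hx _ v).trans ?_
  change g ((trivializationAt F (TangentSpace 𝓘(ℝ, F)) x₀).symmL ℝ x u)
    ((trivializationAt F (TangentSpace 𝓘(ℝ, F)) x₀).symmL ℝ x v) = g u v
  rw [h u, h v, hg L hL]

end IsAffineCover

/-! ### Tensor identities checked on lifted vector fields. -/

namespace IsAffineCover

variable {F X : Type*} [NormedAddCommGroup F] [NormedSpace ℝ F] [TopologicalSpace X]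
  [ChartedSpace F X] {q : F → X} {𝓛 : Set (F ≃L[ℝ] F)}

/-- The differential of a map from the vector space, as an endomorphism. -/
def differential (q : F → X) (y : F) : F →L[ℝ] F := mfderiv 𝓘(ℝ, F) 𝓘(ℝ, F) q y

/-- The lift of a vector field. -/
def lift (q : F → X) (V : X → F) : F → F :=
  VectorField.mpullback 𝓘(ℝ, F) 𝓘(ℝ, F) q V

/-- The Lie bracket of vector fields, which are regarded as functions with values in the model
vector space. -/
def bracket (V W : X → F) : X → F := VectorField.mlieBracket 𝓘(ℝ, F) V W

theorem exists_lift_eq (hq : IsAffineCover q 𝓛) (y : F) :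
    ∃ L ∈ 𝓛, differential q y = L ∧ ∀ V : X → F, V (q y) = L (lift q V y) := by
  obtain ⟨L, hL, h⟩ := hq.mfderiv_mem y
  have h1 : differential q y = L := ContinuousLinearMap.ext h
  refine ⟨L, hL, h1, fun V => ?_⟩
  have h2 : lift q V y = L.symm (V (q y)) := by
    change (differential q y).inverse (V (q y)) = _
    rw [h1, ContinuousLinearMap.inverse_equiv]
    rfl
  rw [h2, L.apply_symm_apply]

theorem lift_comp (hq : IsAffineCover q 𝓛) {J : F →L[ℝ] F}
    (hJ : ∀ L ∈ 𝓛, ∀ u, J (L u) = L (J u)) (V : X → F) :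
    lift q (fun x => J (V x)) = fun y => J (lift q V y) := by
  ext1 y
  obtain ⟨L, hL, -, h⟩ := hq.exists_lift_eq y
  apply L.injective
  rw [← hJ L hL, ← h V, ← h]

/-- Near q y, f is the composite of f' with a local inverse of q, hence differentiable, and the
chain rule applies. -/
theorem dirDeriv_eq (hq : IsAffineCover q 𝓛) (V : X → F) (f : X → ℝ)
    {f' : F → ℝ} (y : F) (hf' : ∀ y, f (q y) = f' y) (hf : DifferentiableAt ℝ f' y) :
    dirDeriv 𝓘(ℝ, F) V f (q y) = fderiv ℝ f' y (lift q V y) := by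
  obtain rfl : f ∘ q = f' := funext hf'
  have hl := hq.isLocalDiffeomorph y
  have hfd : MDifferentiableAt 𝓘(ℝ, F) 𝓘(ℝ, ℝ) f (q y) := by
    have h1 : MDifferentiableAt 𝓘(ℝ, F) 𝓘(ℝ, ℝ) ((f ∘ q) ∘ hl.localInverse) (q y) := by
      refine MDifferentiableAt.comp (I' := 𝓘(ℝ, F)) _ ?_ (hl.localInverse_mdifferentiableAt (by simp))
      rw [hl.localInverse_left_inv hl.localInverse_mem_target]
      exact hf.mdifferentiableAt
    refine h1.congr_of_eventuallyEq ?_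
    filter_upwards [hl.localInverse_eventuallyEq_right] with x hx
    exact congrArg f hx.symm
  obtain ⟨L, hL, h1, h2⟩ := hq.exists_lift_eq y
  have h3 := mfderiv_comp y hfd (hq.isLocalDiffeomorph.mdifferentiable (by simp) y)
  rw [mfderiv_eq_fderiv] at h3
  have h4 : V (q y) = differential q y (lift q V y) := by rw [h1]; exact h2 V
  rw [h3]
  change mfderiv 𝓘(ℝ, F) 𝓘(ℝ, ℝ) f (q y) (V (q y)) = _
  rw [h4]
  rfl

variable [IsManifold 𝓘(ℝ, F) ∞ X]

theorem isSmoothVectorField_comp (hq : IsAffineCover q 𝓛) {J : F →L[ℝ] F}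
    (hJ : ∀ L ∈ 𝓛, ∀ u, J (L u) = L (J u)) {V : X → F}
    (hV : IsSmoothVectorField 𝓘(ℝ, F) V) :
    IsSmoothVectorField 𝓘(ℝ, F) (fun x : X => J (V x)) := by
  have h := hq.isSmoothEndomorphismField_const J hJ
  exact ContMDiff.clm_bundle_apply (E₁ := TangentSpace 𝓘(ℝ, F)) (E₂ := TangentSpace 𝓘(ℝ, F)) h hV

variable [CompleteSpace F]

theorem contDiff_lift (hq : IsAffineCover q 𝓛) {V : X → F}
    (hV : IsSmoothVectorField 𝓘(ℝ, F) V) : ContDiff ℝ ∞ (lift q V) := by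
  have : IsManifold 𝓘(ℝ, F) 1 X := .of_le (n := ∞) (by simp)
  exact contMDiff_vectorSpace_iff_contDiff.1 (ContMDiff.mpullback_vectorField hV
    hq.isLocalDiffeomorph.contMDiff
    (fun y => ⟨hq.isLocalDiffeomorph.mfderivToContinuousLinearEquiv (by simp) y, rfl⟩) (by simp))

theorem lift_bracket (hq : IsAffineCover q 𝓛) {V W : X → F}
    (hV : IsSmoothVectorField 𝓘(ℝ, F) V) (hW : IsSmoothVectorField 𝓘(ℝ, F) W) (y : F) :
    lift q (bracket V W) y =
      fderiv ℝ (lift q W) y (lift q V y) - fderiv ℝ (lift q V) y (lift q W y) := by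
  have h2 : (2 : WithTop ℕ∞) ≤ ∞ := WithTop.coe_le_coe.2 le_top
  have h3 : (3 : WithTop ℕ∞) ≤ ∞ := WithTop.coe_le_coe.2 le_top
  have : IsManifold 𝓘(ℝ, F) (minSmoothness ℝ 3) X := .of_le (n := ∞) (by simpa using h3)
  have : IsManifold 𝓘(ℝ, F) (minSmoothness ℝ 2) X := .of_le (n := ∞) (by simpa using h2)
  have h := VectorField.mpullback_mlieBracket (x₀ := y) (hV.mdifferentiable (by simp) (q y))
    (hW.mdifferentiable (by simp) (q y)) (hq.isLocalDiffeomorph.contMDiff y) (by simpa using h2)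
  rw [← VectorField.mlieBracketWithin_univ (V := VectorField.mpullback 𝓘(ℝ, F) 𝓘(ℝ, F) q V),
    VectorField.mlieBracketWithin_eq_lieBracketWithin] at h
  exact h.trans (congrFun (VectorField.lieBracketWithin_univ (V := lift q V) (W := lift q W)) y)

/-- On lifts J is constant and passes through derivatives, so the torsion terms cancel in pairs
whatever J² is. -/
theorem nijenhuis_const (hq : IsAffineCover q 𝓛) {J : F →L[ℝ] F}
    (hJ : ∀ L ∈ 𝓛, ∀ u, J (L u) = L (J u)) {V W : X → F}
    (hV : IsSmoothVectorField 𝓘(ℝ, F) V) (hW : IsSmoothVectorField 𝓘(ℝ, F) W) (x : X) :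
    nijenhuis 𝓘(ℝ, F) (fun _ => J) V W x = 0 := by
  obtain ⟨y, rfl⟩ := hq.surjective x
  obtain ⟨L, hL, -, h⟩ := hq.exists_lift_eq y
  have hJV := hq.isSmoothVectorField_comp hJ hV
  have hJW := hq.isSmoothVectorField_comp hJ hW
  have e : ∀ {V : X → F}, IsSmoothVectorField 𝓘(ℝ, F) V →
      fderiv ℝ (fun y => J (lift q V y)) y = J.comp (fderiv ℝ (lift q V) y) := fun hV =>
    (J.hasFDerivAt.comp y ((hq.contDiff_lift hV).differentiable (by simp) y).hasFDerivAt).fderiv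
  change J (J (bracket V W (q y))) + bracket (fun x => J (V x)) (fun x => J (W x)) (q y) -
    J (bracket (fun x => J (V x)) W (q y)) - J (bracket V (fun x => J (W x)) (q y)) = 0
  rw [h (bracket V W), h (bracket (fun x => J (V x)) W), h (bracket V (fun x => J (W x))),
    h (bracket (fun x => J (V x)) (fun x => J (W x))), hq.lift_bracket hV hW,
    hq.lift_bracket hJV hW, hq.lift_bracket hV hJW, hq.lift_bracket hJV hJW, hq.lift_comp hJ,
    hq.lift_comp hJ, e hV, e hW, hJ L hL, hJ L hL, hJ L hL, hJ L hL, ← map_add, ← map_sub,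
    ← map_sub]
  simp
  abel

theorem extDerivOneForm_const (hq : IsAffineCover q 𝓛) {η : F →L[ℝ] ℝ}
    (hη : ∀ L ∈ 𝓛, ∀ u, η (L u) = η u) {V W : X → F}
    (hV : IsSmoothVectorField 𝓘(ℝ, F) V) (hW : IsSmoothVectorField 𝓘(ℝ, F) W) (x : X) :
    extDerivOneForm 𝓘(ℝ, F) (fun _ => η) V W x = 0 := by
  obtain ⟨y, rfl⟩ := hq.surjective x
  have e : ∀ {V : X → F} (W : X → F), IsSmoothVectorField 𝓘(ℝ, F) V →
      dirDeriv 𝓘(ℝ, F) W (fun x => η (V x)) (q y) =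
        η (fderiv ℝ (lift q V) y (lift q W y)) := fun {V} W hV => by
    have hd := (hq.contDiff_lift hV).differentiable (by simp) y
    have hd' : HasFDerivAt (fun y => η (lift q V y)) (η.comp (fderiv ℝ (lift q V) y)) y :=
      η.hasFDerivAt.comp y hd.hasFDerivAt
    rw [hq.dirDeriv_eq W _ y (f' := fun y => η (lift q V y)) (fun y => ?_) hd'.differentiableAt,
      hd'.fderiv]
    · rfl
    · obtain ⟨L, hL, -, h⟩ := hq.exists_lift_eq y
      rw [h V, hη L hL]
  obtain ⟨L, hL, -, h⟩ := hq.exists_lift_eq y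
  change dirDeriv 𝓘(ℝ, F) V (fun x => η (W x)) (q y) - dirDeriv 𝓘(ℝ, F) W (fun x => η (V x)) (q y) -
    η (bracket V W (q y)) = 0
  rw [e V hW, e W hV, h (bracket V W), hη L hL, hq.lift_bracket hV hW, map_sub, sub_self]

/-- The product rule for constant σ yields six terms, which skew-symmetry matches with the six from
the three brackets. -/
theorem extDerivTwoForm_const (hq : IsAffineCover q 𝓛) {σ : F →L[ℝ] F →L[ℝ] ℝ}
    (hσ : ∀ L ∈ 𝓛, ∀ u v, σ (L u) (L v) = σ u v) (ha : ∀ u v, σ u v = -σ v u)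
    {U V W : X → F} (hU : IsSmoothVectorField 𝓘(ℝ, F) U)
    (hV : IsSmoothVectorField 𝓘(ℝ, F) V) (hW : IsSmoothVectorField 𝓘(ℝ, F) W) (x : X) :
    extDerivTwoForm 𝓘(ℝ, F) (fun _ u v => σ u v) U V W x = 0 := by
  obtain ⟨y, rfl⟩ := hq.surjective x
  have e : ∀ {V W : X → F} (U : X → F),
      IsSmoothVectorField 𝓘(ℝ, F) V → IsSmoothVectorField 𝓘(ℝ, F) W →
      dirDeriv 𝓘(ℝ, F) U (fun x => σ (V x) (W x)) (q y) =
        σ (lift q V y) (fderiv ℝ (lift q W) y (lift q U y)) +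
          σ (fderiv ℝ (lift q V) y (lift q U y)) (lift q W y) := fun {V W} U hV hW => by
    have hd := ((hq.contDiff_lift hV).differentiable (by simp) y).hasFDerivAt
    have hd' := ((hq.contDiff_lift hW).differentiable (by simp) y).hasFDerivAt
    have hs := σ.hasFDerivAt_of_bilinear hd hd'
    rw [hq.dirDeriv_eq U _ y (f' := fun y => σ (lift q V y) (lift q W y)) (fun y => ?_)
      hs.differentiableAt, hs.fderiv]
    · rfl
    · obtain ⟨L, hL, -, h⟩ := hq.exists_lift_eq y
      rw [h V, h W, hσ L hL]
  obtain ⟨L, hL, -, h⟩ := hq.exists_lift_eq y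
  change dirDeriv 𝓘(ℝ, F) U (fun x => σ (V x) (W x)) (q y) +
    dirDeriv 𝓘(ℝ, F) V (fun x => σ (W x) (U x)) (q y) +
    dirDeriv 𝓘(ℝ, F) W (fun x => σ (U x) (V x)) (q y) - σ (bracket U V (q y)) (W (q y)) -
    σ (bracket V W (q y)) (U (q y)) - σ (bracket W U (q y)) (V (q y)) = 0
  rw [e U hV hW, e V hW hU, e W hU hV, h (bracket U V), h (bracket V W), h (bracket W U), h U, h V,
    h W, hσ L hL, hσ L hL, hσ L hL, hq.lift_bracket hU hV, hq.lift_bracket hV hW,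
    hq.lift_bracket hW hU]
  simp only [map_sub, sub_apply]
  rw [ha (lift q V y), ha (lift q W y), ha (lift q U y)]
  ring

end IsAffineCover

/-! ### Kähler and co-Kähler structures from invariant linear data. -/

namespace IsAffineCover

variable {F X : Type*} [NormedAddCommGroup F] [NormedSpace ℝ F] [TopologicalSpace X]

theorem of_isLocalHomeomorph {q : F → X} (hq : IsLocalHomeomorph q) (hs : Function.Surjective q)
    {𝓛 : Set (F ≃L[ℝ] F)} (h : ∀ y y', q y = q y' → ∃ L ∈ 𝓛, ∀ w, q (y' + L (w - y)) = q w) :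
    letI : ChartedSpace F X := hq.chartedSpace hs
    IsAffineCover q 𝓛 := by
  let : ChartedSpace F X := hq.chartedSpace hs
  refine ⟨hs, hq, ?_, h⟩
  rintro _ ⟨x, rfl⟩ y hy
  simp [chartAt_self_eq]

variable [ChartedSpace F X] {q : F → X} {𝓛 : Set (F ≃L[ℝ] F)}

theorem contMDiff_of_semiconj (hq : IsAffineCover q 𝓛) {φ : X → X} (A : F →L[ℝ] F)
    (h : ∀ y, φ (q y) = q (A y)) : ContMDiff 𝓘(ℝ, F) 𝓘(ℝ, F) ∞ φ := by
  intro x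
  obtain ⟨y, rfl⟩ := hq.surjective x
  have hl := hq.isLocalDiffeomorph y
  have h1 : ContMDiff 𝓘(ℝ, F) 𝓘(ℝ, F) ∞ (q ∘ A) :=
    hq.isLocalDiffeomorph.contMDiff.comp A.contMDiff
  refine (ContMDiffAt.comp (I' := 𝓘(ℝ, F)) _ (h1 _) hl.localInverse_contMDiffAt).congr_of_eventuallyEq
    ?_
  filter_upwards [hl.localInverse_eventuallyEq_right] with x hx
  rw [Function.comp_apply, Function.comp_apply, ← h]
  exact congrArg φ hx.symm

theorem mfderiv_of_semiconj (hq : IsAffineCover q 𝓛) {φ : X → X} (A : F →L[ℝ] F)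
    (h : ∀ y, φ (q y) = q (A y)) (y u : F) :
    mfderiv 𝓘(ℝ, F) 𝓘(ℝ, F) φ (q y) (differential q y u) = differential q (A y) (A u) := by
  have hφ := (hq.contMDiff_of_semiconj A h).mdifferentiable (by simp)
  have hd := hq.isLocalDiffeomorph.mdifferentiable (by simp)
  have h1 := mfderiv_comp y (hφ (q y)) (hd y)
  have h2 := mfderiv_comp y (hd (A y)) A.differentiableAt.mdifferentiableAt
  rw [show φ ∘ q = q ∘ A from funext h, h2, mfderiv_eq_fderiv, A.fderiv] at h1
  exact (DFunLike.congr_fun h1 u).symm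

variable [IsManifold 𝓘(ℝ, F) ∞ X]

/-- The Riemannian metric given by an invariant inner product. -/
def riemannianMetric (hq : IsAffineCover q 𝓛) (g : F →L[ℝ] F →L[ℝ] ℝ)
    (hg : ∀ L ∈ 𝓛, ∀ u v, g (L u) (L v) = g u v) (hs : ∀ u v, g u v = g v u)
    (hb : ∀ u, ‖u‖ ^ 2 ≤ g u u) :
    Bundle.ContMDiffRiemannianMetric 𝓘(ℝ, F) ∞ F (fun x : X => TangentSpace 𝓘(ℝ, F) x) where
  inner _ := g
  symm _ := hs
  pos _ v hv := (pow_pos (norm_pos_iff.2 hv) 2).trans_le (hb v)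
  isVonNBounded _ := by
    refine (NormedSpace.isVonNBounded_ball ℝ F 1).subset fun v (hv : g v v < 1) => ?_
    have h := (hb v).trans_lt hv
    exact mem_ball_zero_iff.2 ((sq_lt_one_iff₀ (norm_nonneg _)).1 h)
  contMDiff := hq.contMDiff_bilinear_const g hg

variable [CompleteSpace F]

/-- The Kähler structure given by an invariant Hermitian structure on the vector space. -/
def kahlerStructure (hq : IsAffineCover q 𝓛) (J : F →L[ℝ] F) (g : F →L[ℝ] F →L[ℝ] ℝ)
    (hJ : ∀ L ∈ 𝓛, ∀ u, J (L u) = L (J u))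
    (hg : ∀ L ∈ 𝓛, ∀ u v, g (L u) (L v) = g u v) (hs : ∀ u v, g u v = g v u)
    (hb : ∀ u, ‖u‖ ^ 2 ≤ g u u) (hJJ : ∀ u, J (J u) = -u) (hgJ : ∀ u v, g (J u) (J v) = g u v) :
    KahlerStructure 𝓘(ℝ, F) X where
  J _ := J
  g := hq.riemannianMetric g hg hs hb
  smooth_J := hq.isSmoothEndomorphismField_const J hJ
  J_sq _ := hJJ
  compatible _ := hgJ
  integrable _ _ hU hV := hq.nijenhuis_const hJ hU hV
  closed _ _ _ hU hV hW := by
    refine hq.extDerivTwoForm_const (σ := g.comp J) (fun L hL u v => ?_) (fun u v => ?_) hU hV hW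
    · change g (J (L u)) (L v) = g (J u) v
      rw [hJ L hL, hg L hL]
    · change g (J u) v = -g (J v) u
      rw [← hgJ (J u) v, hJJ, hs (J v) u, map_neg]
      rfl

/-- The co-Kähler structure given by invariant tensors on the vector space. -/
def coKahlerStructure (hq : IsAffineCover q 𝓛) (J : F →L[ℝ] F) (ξ : F) (η : F →L[ℝ] ℝ)
    (g : F →L[ℝ] F →L[ℝ] ℝ) (hJ : ∀ L ∈ 𝓛, ∀ u, J (L u) = L (J u)) (hξ : ∀ L ∈ 𝓛, L ξ = ξ)
    (hη : ∀ L ∈ 𝓛, ∀ u, η (L u) = η u) (hg : ∀ L ∈ 𝓛, ∀ u v, g (L u) (L v) = g u v)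
    (hs : ∀ u v, g u v = g v u) (hb : ∀ u, ‖u‖ ^ 2 ≤ g u u)
    (hJJ : ∀ u, J (J u) = -u + η u • ξ) (hηξ : η ξ = 1)
    (hgJ : ∀ u v, g (J u) (J v) = g u v - η u * η v) (hskew : ∀ u v, g (J u) v = -g (J v) u) :
    CoKahlerStructure 𝓘(ℝ, F) X where
  J _ := J
  ξ _ := ξ
  η _ := η
  g := hq.riemannianMetric g hg hs hb
  smooth_J := hq.isSmoothEndomorphismField_const J hJ
  smooth_ξ := hq.isSmoothVectorField_const ξ hξ
  smooth_η := hq.isSmoothOneForm_const η hη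
  J_sq _ := hJJ
  η_ξ _ := hηξ
  compatible _ := hgJ
  normal _ _ hU hV x := by
    rw [hq.extDerivOneForm_const hη hU hV]
    refine (congrArg (· + ((2 * 0 : ℝ) • ξ : F)) (hq.nijenhuis_const hJ hU hV x)).trans ?_
    change (0 : F) + _ = 0
    rw [mul_zero, zero_smul, add_zero]
  closed_omega _ _ _ hU hV hW := by
    refine hq.extDerivTwoForm_const (σ := g.comp J) (fun L hL u v => ?_) hskew hU hV hW
    change g (J (L u)) (L v) = g (J u) v
    rw [hJ L hL, hg L hL]
  closed_eta _ _ hU hV := hq.extDerivOneForm_const hη hU hV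

end IsAffineCover

/-! ### The Hermitian structure of `ℂⁿ` -/

section

variable (n : ℕ)

/-- Multiplication by `i` on `ℂⁿ`. -/
def mulI : EuclideanSpace ℂ (Fin n) →L[ℝ] EuclideanSpace ℂ (Fin n) := Complex.I • .id ℝ _

/-- The real part of the Hermitian inner product on `ℂⁿ`. -/
def realInner : EuclideanSpace ℂ (Fin n) →L[ℝ] EuclideanSpace ℂ (Fin n) →L[ℝ] ℝ := innerSL ℝ

/-- Multiplication by a non-zero complex number on `ℂⁿ`. -/
def scale (c : ℂˣ) : EuclideanSpace ℂ (Fin n) ≃L[ℝ] EuclideanSpace ℂ (Fin n) :=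
  ContinuousLinearEquiv.smulLeft c

variable {n}

theorem mulI_apply (u : EuclideanSpace ℂ (Fin n)) : mulI n u = Complex.I • u := rfl

theorem mulI_mulI (u : EuclideanSpace ℂ (Fin n)) : mulI n (mulI n u) = -u := by
  simp [mulI_apply, smul_smul]

theorem mulI_smul (c : ℂ) (u : EuclideanSpace ℂ (Fin n)) : mulI n (c • u) = c • mulI n u :=
  smul_comm Complex.I c u

theorem realInner_apply (u v : EuclideanSpace ℂ (Fin n)) : realInner n u v = (inner ℂ u v).re := by
  rw [realInner, innerSL_apply_apply]
  simp [PiLp.inner_apply, mul_comm]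

theorem realInner_comm (u v : EuclideanSpace ℂ (Fin n)) : realInner n u v = realInner n v u := by
  rw [realInner, innerSL_apply_apply, innerSL_apply_apply, real_inner_comm]

theorem realInner_self (u : EuclideanSpace ℂ (Fin n)) : realInner n u u = ‖u‖ ^ 2 := by
  rw [realInner, innerSL_apply_apply, real_inner_self_eq_norm_sq]

theorem realInner_smul {c : ℂ} (hc : ‖c‖ = 1) (u v : EuclideanSpace ℂ (Fin n)) :
    realInner n (c • u) (c • v) = realInner n u v := by
  rw [realInner_apply, realInner_apply, inner_smul_left, inner_smul_right, ← mul_assoc,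
    ← Complex.normSq_eq_conj_mul_self, Complex.normSq_eq_norm_sq, hc]
  simp

theorem realInner_mulI (u v : EuclideanSpace ℂ (Fin n)) :
    realInner n (mulI n u) (mulI n v) = realInner n u v :=
  realInner_smul Complex.norm_I u v

theorem realInner_mulI_left (u v : EuclideanSpace ℂ (Fin n)) :
    realInner n (mulI n u) v = -realInner n (mulI n v) u := by
  rw [← realInner_mulI (mulI n u), mulI_mulI, realInner_comm (mulI n v), map_neg]
  rfl

end

/-! ### The Kähler structure of `T²ⁿ` and the co-Kähler structure of `T²ⁿ_B` -/

theorem exists_deck_torusProj {n : ℕ} {z z' : EuclideanSpace ℂ (Fin n)}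
    (h : torusProj n z = torusProj n z') :
    ∃ L ∈ ({.refl ℝ _} : Set (EuclideanSpace ℂ (Fin n) ≃L[ℝ] EuclideanSpace ℂ (Fin n))),
      ∀ w, torusProj n (z' + L (w - z)) = torusProj n w := by
  refine ⟨_, rfl, fun w => ?_⟩
  rw [ContinuousLinearEquiv.refl_apply, torusProj_add, torusProj_sub, h, add_sub_cancel]

/-- The linear parts of the deck transformations of `ℂⁿ × ℝ → T²ⁿ_B`. -/
def deckLinear (n : ℕ) :
    Set ((EuclideanSpace ℂ (Fin n) × ℝ) ≃L[ℝ] (EuclideanSpace ℂ (Fin n) × ℝ)) :=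
  Set.range fun k : ℤ => (scale n (Units.mk0 zeta zeta_ne_zero ^ k)).prodCongr (.refl ℝ ℝ)

theorem exists_zpow_of_mem_deckLinear {n : ℕ}
    {L : (EuclideanSpace ℂ (Fin n) × ℝ) ≃L[ℝ] (EuclideanSpace ℂ (Fin n) × ℝ)}
    (hL : L ∈ deckLinear n) : ∃ k : ℤ, ∀ u, L u = (zeta ^ k • u.1, u.2) := by
  obtain ⟨k, rfl⟩ := hL
  refine ⟨k, fun u => Prod.ext ?_ rfl⟩
  change (Units.mk0 zeta zeta_ne_zero ^ k) • u.1 = zeta ^ k • u.1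
  rw [Units.smul_def, Units.val_zpow_eq_zpow_val, Units.val_mk0]

theorem exists_deck_torusBProj {n : ℕ} {p p' : EuclideanSpace ℂ (Fin n) × ℝ}
    (h : torusBProj n p = torusBProj n p') :
    ∃ L ∈ deckLinear n, ∀ w, torusBProj n (p' + L (w - p)) = torusBProj n w := by
  obtain ⟨k, l, hl, rfl⟩ := torusBProj_eq_iff.1 h
  refine ⟨_, ⟨k, rfl⟩, fun w => ?_⟩
  rw [eq_comm, torusBProj_eq_iff]
  refine ⟨k, l, hl, Prod.ext ?_ ?_⟩
  · change zeta ^ k • p.1 + l + (Units.mk0 zeta zeta_ne_zero ^ k) • (w.1 - p.1) =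
      zeta ^ k • w.1 + l
    rw [Units.smul_def, Units.val_zpow_eq_zpow_val, Units.val_mk0, smul_sub]
    abel
  · change p.2 + k + (w.2 - p.2) = w.2 + k
    ring

section CoKahlerTensors

variable (n : ℕ)

/-- The endomorphism `(z, t) ↦ (i z, 0)`. -/
def mulIProd : EuclideanSpace ℂ (Fin n) × ℝ →L[ℝ] EuclideanSpace ℂ (Fin n) × ℝ :=
  ((mulI n).comp (.fst ℝ _ _)).prod 0

/-- The product inner product on `ℂⁿ × ℝ`. -/
def realInnerProd :
    EuclideanSpace ℂ (Fin n) × ℝ →L[ℝ] EuclideanSpace ℂ (Fin n) × ℝ →L[ℝ] ℝ :=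
  (realInner n).bilinearComp (.fst ℝ _ _) (.fst ℝ _ _) +
    (ContinuousLinearMap.mul ℝ ℝ).bilinearComp (.snd ℝ _ _) (.snd ℝ _ _)

variable {n}

theorem mulIProd_apply (u : EuclideanSpace ℂ (Fin n) × ℝ) : mulIProd n u = (mulI n u.1, 0) := rfl

theorem realInnerProd_apply (u v : EuclideanSpace ℂ (Fin n) × ℝ) :
    realInnerProd n u v = realInner n u.1 v.1 + u.2 * v.2 := rfl

end CoKahlerTensors

theorem norm_zeta_zpow (k : ℤ) : ‖zeta ^ k‖ = 1 := by rw [norm_zpow, norm_zeta, one_zpow]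

/-- The co-Kähler structure of a manifold covered by `ℂⁿ × ℝ → T²ⁿ_B`. -/
def IsAffineCover.torusBStructure {n : ℕ} [ChartedSpace (EuclideanSpace ℂ (Fin n) × ℝ) (TorusB n)]
    [IsManifold 𝓘(ℝ, EuclideanSpace ℂ (Fin n) × ℝ) ∞ (TorusB n)]
    (hq : IsAffineCover (torusBProj n) (deckLinear n)) :
    CoKahlerStructure 𝓘(ℝ, EuclideanSpace ℂ (Fin n) × ℝ) (TorusB n) := by
  refine hq.coKahlerStructure (mulIProd n) (0, 1) (.snd ℝ _ _) (realInnerProd n) (fun L hL u => ?_)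
    (fun L hL => ?_) (fun L hL u => ?_) (fun L hL u v => ?_) (fun u v => ?_) (fun u => ?_)
    (fun u => ?_) rfl (fun u v => ?_) (fun u v => ?_)
  · obtain ⟨k, h⟩ := exists_zpow_of_mem_deckLinear hL
    simp only [h, mulIProd_apply, mulI_smul]
  · obtain ⟨k, h⟩ := exists_zpow_of_mem_deckLinear hL
    simp [h]
  · obtain ⟨k, h⟩ := exists_zpow_of_mem_deckLinear hL
    simp [h]
  · obtain ⟨k, h⟩ := exists_zpow_of_mem_deckLinear hL
    simp only [h, realInnerProd_apply, realInner_smul (norm_zeta_zpow k)]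
  · rw [realInnerProd_apply, realInnerProd_apply, realInner_comm, mul_comm]
  · rw [realInnerProd_apply, realInner_self, Prod.norm_def, Real.norm_eq_abs]
    -- The product carries the maximum norm, so its square is only bounded by the metric; this is
    -- why the general construction asks for an inequality.
    rcases max_cases ‖u.1‖ |u.2| with h | h <;> rw [h.1] <;> nlinarith [sq_abs u.2]
  · refine Prod.ext ?_ ?_ <;> simp [mulIProd_apply, mulI_mulI]
  · simp [realInnerProd_apply, mulIProd_apply, realInner_mulI]
  · simp only [realInnerProd_apply, mulIProd_apply, zero_mul, add_zero]
    exact realInner_mulI_left _ _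

/-- The Kähler structure of a manifold covered by `ℂⁿ → T²ⁿ`. -/
def IsAffineCover.torusStructure {n : ℕ} [ChartedSpace (EuclideanSpace ℂ (Fin n)) (Torus n)]
    [IsManifold 𝓘(ℝ, EuclideanSpace ℂ (Fin n)) ∞ (Torus n)]
    (hq : IsAffineCover (torusProj n) {.refl ℝ _}) :
    KahlerStructure 𝓘(ℝ, EuclideanSpace ℂ (Fin n)) (Torus n) :=
  hq.kahlerStructure (mulI n) (realInner n) (by rintro _ rfl u; rfl) (by rintro _ rfl u v; rfl)
    realInner_comm (fun u => (realInner_self u).ge) mulI_mulI realInner_mulI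

theorem IsAffineCover.differential_torusProj {n : ℕ}
    [ChartedSpace (EuclideanSpace ℂ (Fin n)) (Torus n)]
    (hq : IsAffineCover (torusProj n) {.refl ℝ _}) (z u : EuclideanSpace ℂ (Fin n)) :
    differential (torusProj n) z u = u := by
  obtain ⟨L, rfl, h, -⟩ := hq.exists_lift_eq z
  rw [h]
  rfl

/-- The differential of `torusProj` is the identity, so that of B is multiplication by ζ, which is
complex linear and unitary. -/
theorem IsAffineCover.isHermitianIsometry_torusB {n : ℕ}
    [ChartedSpace (EuclideanSpace ℂ (Fin n)) (Torus n)]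
    [IsManifold 𝓘(ℝ, EuclideanSpace ℂ (Fin n)) ∞ (Torus n)]
    (hq : IsAffineCover (torusProj n) {.refl ℝ _}) :
    hq.torusStructure.IsHermitianIsometry (torusB n) := by
  let A : EuclideanSpace ℂ (Fin n) →L[ℝ] EuclideanSpace ℂ (Fin n) :=
    scale n (Units.mk0 zeta zeta_ne_zero)
  let T : Torus n → EuclideanSpace ℂ (Fin n) →L[ℝ] EuclideanSpace ℂ (Fin n) :=
    mfderiv 𝓘(ℝ, EuclideanSpace ℂ (Fin n)) 𝓘(ℝ, EuclideanSpace ℂ (Fin n)) (torusB n)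
  have h : ∀ x u, T x u = zeta • u := by
    intro x u
    obtain ⟨z, rfl⟩ := hq.surjective x
    have h1 := hq.mfderiv_of_semiconj A (torusB_torusProj n) z u
    rwa [hq.differential_torusProj, hq.differential_torusProj] at h1
  refine ⟨hq.contMDiff_of_semiconj A (torusB_torusProj n), fun x u => ?_, fun x u v => ?_⟩
  · refine (h x (mulI n u)).trans ((mulI_smul zeta u).symm.trans (congrArg (mulI n) (h x u).symm))
  · exact (congrArg₂ (fun u v => realInner n u v) (h x u) (h x v)).trans
      (realInner_smul norm_zeta u v)

/-- Locally the map is an inverse branch of `torusProj` times the identity, followed by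
`torusBProj`. -/
theorem isLocalDiffeomorph_cover_torusB {n : ℕ}
    [ChartedSpace (EuclideanSpace ℂ (Fin n)) (Torus n)]
    [ChartedSpace (EuclideanSpace ℂ (Fin n) × ℝ) (TorusB n)]
    (h : IsLocalDiffeomorph 𝓘(ℝ, EuclideanSpace ℂ (Fin n)) 𝓘(ℝ, EuclideanSpace ℂ (Fin n)) ∞
      (torusProj n))
    (h' : IsLocalDiffeomorph 𝓘(ℝ, EuclideanSpace ℂ (Fin n) × ℝ)
      𝓘(ℝ, EuclideanSpace ℂ (Fin n) × ℝ) ∞ (torusBProj n)) :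
    IsLocalDiffeomorph (𝓘(ℝ, EuclideanSpace ℂ (Fin n)).prod 𝓘(ℝ, ℝ))
      𝓘(ℝ, EuclideanSpace ℂ (Fin n) × ℝ) ∞ (MappingTorus.cover (torusB n)) := by
  rintro ⟨x, t⟩
  obtain ⟨z, rfl⟩ := torusProj_surjective n x
  obtain ⟨Φ, hz, hΦ⟩ := h z
  obtain ⟨Θ, hp, hΘ⟩ := h' (z, t)
  let Ψ : PartialDiffeomorph (𝓘(ℝ, EuclideanSpace ℂ (Fin n)).prod 𝓘(ℝ, ℝ))
      𝓘(ℝ, EuclideanSpace ℂ (Fin n) × ℝ) (Torus n × ℝ) (EuclideanSpace ℂ (Fin n) × ℝ) ∞ :=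
    { toPartialEquiv := Φ.symm.toPartialEquiv.prod (.refl ℝ)
      open_source := Φ.open_target.prod isOpen_univ
      open_target := Φ.open_source.prod isOpen_univ
      contMDiffOn_toFun := ContMDiffOn.prodMk_space
        (Φ.contMDiffOn_invFun.comp contMDiff_fst.contMDiffOn fun p hp => hp.1)
        contMDiff_snd.contMDiffOn
      contMDiffOn_invFun := ContMDiffOn.prodMk
        (Φ.contMDiffOn_toFun.comp contDiff_fst.contMDiff.contMDiffOn fun p hp => hp.1)
        contDiff_snd.contMDiff.contMDiffOn }
  have hx : torusProj n z ∈ Φ.target := by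
    rw [hΦ hz]
    exact Φ.map_source hz
  have hz' : Φ.invFun (torusProj n z) = z := by
    rw [hΦ hz]
    exact Φ.left_inv hz
  refine ⟨Ψ.trans Θ, ⟨⟨hx, trivial⟩, ?_⟩, ?_⟩
  · change (Φ.invFun (torusProj n z), t) ∈ Θ.source
    rwa [hz']
  · rintro p ⟨⟨hp1, -⟩, hp2⟩
    refine Eq.trans ?_ (hΘ hp2)
    have hp3 : torusProj n (Φ.invFun p.1) = p.1 :=
      (hΦ (Φ.map_target hp1)).trans (Φ.right_inv hp1)
    change _ = MappingTorus.cover (torusB n) (torusProj n (Φ.invFun p.1), p.2)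
    rw [hp3]

end

theorem mainTheorem10 (n : ℕ) (hn : 1 ≤ n) :
    -- `T²ⁿ` is a compact Kähler manifold, with structure inherited from `ℂⁿ`,
    -- and `B` is a Hermitian isometry of order `6`
    (∃ (_ : ChartedSpace (EuclideanSpace ℂ (Fin n)) (Torus n))
        (_ : IsManifold 𝓘(ℝ, EuclideanSpace ℂ (Fin n)) ∞ (Torus n))
        (S : KahlerStructure 𝓘(ℝ, EuclideanSpace ℂ (Fin n)) (Torus n)),
      IsLocalDiffeomorph 𝓘(ℝ, EuclideanSpace ℂ (Fin n)) 𝓘(ℝ, EuclideanSpace ℂ (Fin n)) ∞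
        (torusProj n) ∧
      (∀ z u : EuclideanSpace ℂ (Fin n),
        S.J (torusProj n z)
          (mfderiv 𝓘(ℝ, EuclideanSpace ℂ (Fin n)) 𝓘(ℝ, EuclideanSpace ℂ (Fin n))
            (torusProj n) z u) =
          mfderiv 𝓘(ℝ, EuclideanSpace ℂ (Fin n)) 𝓘(ℝ, EuclideanSpace ℂ (Fin n))
            (torusProj n) z (Complex.I • u)) ∧
      (∀ z u v : EuclideanSpace ℂ (Fin n),
        S.g.inner (torusProj n z)
          (mfderiv 𝓘(ℝ, EuclideanSpace ℂ (Fin n)) 𝓘(ℝ, EuclideanSpace ℂ (Fin n))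
            (torusProj n) z u)
          (mfderiv 𝓘(ℝ, EuclideanSpace ℂ (Fin n)) 𝓘(ℝ, EuclideanSpace ℂ (Fin n))
            (torusProj n) z v) = (inner ℂ u v).re) ∧
      S.IsHermitianIsometry (torusB n) ∧
      -- the mapping torus, with its smooth structure of dimension `2n + 1` as a quotient of
      -- `T²ⁿ × ℝ`, is co-Kähler
      ∃ (_ : ChartedSpace (EuclideanSpace ℂ (Fin n) × ℝ) (TorusB n))
        (_ : IsManifold 𝓘(ℝ, EuclideanSpace ℂ (Fin n) × ℝ) ∞ (TorusB n)),
        IsLocalDiffeomorph (𝓘(ℝ, EuclideanSpace ℂ (Fin n)).prod 𝓘(ℝ, ℝ))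
          𝓘(ℝ, EuclideanSpace ℂ (Fin n) × ℝ) ∞ (MappingTorus.cover (torusB n)) ∧
        Nonempty (CoKahlerStructure 𝓘(ℝ, EuclideanSpace ℂ (Fin n) × ℝ) (TorusB n))) ∧
    orderOf (torusB n) = 6 ∧
    CompactSpace (Torus n) ∧ T2Space (Torus n) ∧
    CompactSpace (TorusB n) ∧ T2Space (TorusB n) ∧
    -- homology and fundamental group
    Nonempty (H₁ (TorusB n) ≃ₗ[ℤ] ℤ) ∧
    firstBetti (TorusB n) = 1 ∧
    (∀ x : TorusB n, Group.IsSolvable (FundamentalGroup (TorusB n) x)) ∧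
    -- a six-sheeted covering by the torus `T²ⁿ × S¹`
    (∃ p : Torus n × Circle → TorusB n,
      IsCoveringMap p ∧ ∀ y : TorusB n, Nat.card (p ⁻¹' {y}) = 6) ∧
    -- it is not a product
    (∀ (K : Type*) [TopologicalSpace K] [T2Space K] [CompactSpace K]
      [ChartedSpace (EuclideanSpace ℝ (Fin (2 * n))) K],
      IsEmpty (TorusB n ≃ₜ K × Circle)) := by
  refine ⟨?_, orderOf_torusB hn, inferInstance, inferInstance, inferInstance, inferInstance,
    nonempty_H₁_torusB_equiv n, firstBetti_torusB n, isSolvable_fundamentalGroup_torusB n,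
    exists_six_sheeted_covering hn, fun K => isEmpty_torusB_homeomorph_prod_circle hn K⟩
  let _ : ChartedSpace (EuclideanSpace ℂ (Fin n)) (Torus n) :=
    (isLocalHomeomorph_torusProj n).chartedSpace (torusProj_surjective n)
  have hq : IsAffineCover (torusProj n) {.refl ℝ _} :=
    .of_isLocalHomeomorph _ _ fun _ _ => exists_deck_torusProj
  have hm := hq.isManifold
  have hl : IsLocalHomeomorph (torusBProj n) :=
    (isQuotientCoveringMap_torusBProj n).isCoveringMap.isLocalHomeomorph
  have hs : Function.Surjective (torusBProj n) := (isOpenQuotientMap_torusBProj n).surjective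
  let _ : ChartedSpace (EuclideanSpace ℂ (Fin n) × ℝ) (TorusB n) := hl.chartedSpace hs
  have hq' : IsAffineCover (torusBProj n) (deckLinear n) :=
    .of_isLocalHomeomorph _ _ fun _ _ => exists_deck_torusBProj
  have hm' := hq'.isManifold
  refine ⟨inferInstance, hm, hq.torusStructure, hq.isLocalDiffeomorph, fun z u => ?_,
    fun z u v => ?_, hq.isHermitianIsometry_torusB, inferInstance, hm',
    isLocalDiffeomorph_cover_torusB hq.isLocalDiffeomorph hq'.isLocalDiffeomorph,
    ⟨hq'.torusBStructure⟩⟩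
  · exact (congrArg (mulI n) (hq.differential_torusProj z u)).trans
      (hq.differential_torusProj z (mulI n u)).symm
  · exact (congrArg₂ (fun u v => realInner n u v) (hq.differential_torusProj z u)
      (hq.differential_torusProj z v)).trans (realInner_apply u v)
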